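/- Notation. Let $d\ge 1$. For $u\in\mathscr S'(\mathbf R^d)$ and $\varphi\in\mathscr S(\mathbf R^d)$ let $(u,\varphi)$ be the action that is linear in $u$, conjugate linear in $\varphi$, and extends the $L^2$ inner product. Put $V_\varphi u(x,\xi)=(2\pi)^{-d/2}\,\bigl(u,\ e^{i\langle\cdot,\xi\rangle}\varphi(\cdot-x)\bigr)$ for $x,\xi\in\mathbf R^d$. Let $D^\alpha=(-i)^{|\alpha|}\partial^\alpha$ and $\langle (x,\xi)\rangle=(1+|x|^2+|\xi|^2)^{1/2}$. For $s,t>0$ let $\Sigma_t^s(\mathbf R^d)$ be the space of $f\in C^\infty(\mathbf R^d)$ (necessarily Schwartz functions) with $$\sup_{x,\alpha,\beta}\frac{|x^\alpha D^\beta f(x)|}{h^{|\alpha+\beta|}\,\alpha!^t\,\beta!^s}<\infty\qquad\text{for all } h>0 .$$ Fix a window $\varphi\in\mathscr S(\mathbf R^d)\setminus 0$. For $u\in\mathscr S'(\mathbf R^d)$, the Gabor wave front set $\mathrm{WF_g}(u)$ is the set of $z_0\in\mathbf R^{2d}\setminus 0$ for which there is no open conic set $\Gamma\subseteq\mathbf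 R^{2d}\setminus 0$ with $z_0\in\Gamma$ and $\sup_{z\in\Gamma}\langle z\rangle^N|V_\varphi u(z)|<\infty$ for all $N\ge 0$. Fix $s,t>0$ with $s+t>1$ and a window $\psi\in\Sigma_t^s(\mathbf R^d)\setminus 0$. For $u\in\mathscr S'(\mathbf R^d)$, the $t,s$-Gelfand--Shilov wave front set $\mathrm{WF}^{t,s}(u)$ is the set of $z_0\in\mathbf R^{2d}\setminus 0$ for which there is no open set $U\subseteq\mathbf R^{2d}\setminus 0$ with $z_0\in U$ and $$\sup_{\lambda>0,\ (x,\xi)\in U}e^{r\lambda}\,|V_\psi u(\lambda^t x,\lambda^s\xi)|<\infty\qquad\text{for all } r>0 .$$ Proposition. Let $s,t>0$ with $s+t>1$, let $m\ge 1$, and let $$p(x)=\sum_{|\alpha|\le m}c_\alpha x^\alpha,\qquad x\in\mathbf R^d,\ c_\alpha\in\mathbf C,$$ be a polynomial that is not identically zero. Put $$u=\sum_{|\alpha|\le m}c_\alpha D^\alpha\delta_0\in\mathscr S'(\mathbf R^d).$$ Then, for every choice of windows $\varphi\in\mathscr S(\mathbf R^d)\setminus 0$ and $\psi\in\Sigma_t^s(\mathbf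 R^d)\setminus 0$, $$\mathrm{WF_g}(u)=\mathrm{WF}^{t,s}(u)=\{0\}\times(\mathbf R^d\setminus 0)$$ and $$\mathrm{WF_g}(p)=\mathrm{WF}^{t,s}(p)=(\mathbf R^d\setminus 0)\times\{0\}.$$ -/

import Mathlib

open scoped SchwartzMap LineDeriv

namespace AnisotropicWF

/-- The space `ℝ^d` with its Euclidean structure. -/
abbrev Rd (d : ℕ) := EuclideanSpace ℝ (Fin d)

/-- The oscillation `y ↦ exp (i ⟨y, ξ⟩)`. -/
noncomputable def planeWave {d : ℕ} (ξ : Rd d) (y : Rd d) : ℂ :=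
  Complex.exp (Complex.I * ((inner ℝ y ξ : ℝ) : ℂ))

theorem planeWave_hasTemperateGrowth {d : ℕ} (ξ : Rd d) :
    (planeWave ξ).HasTemperateGrowth := by
  have hderiv : ∀ n : ℕ, iteratedDeriv n (fun r : ℝ => Complex.exp (Complex.I * (r : ℂ))) =
      fun r : ℝ => Complex.I ^ n * Complex.exp (Complex.I * (r : ℂ)) := by
    intro n
    induction n with
    | zero => simp
    | succ n ih =>
      rw [iteratedDeriv_succ, ih]
      ext r
      have h1 : HasDerivAt (fun r : ℝ => Complex.I * (r : ℂ)) (Complex.I * 1) r :=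
        (Complex.ofRealCLM.hasDerivAt (x := r)).const_mul Complex.I
      rw [(h1.cexp.const_mul (Complex.I ^ n)).deriv]
      ring
  have hexp : (fun r : ℝ => Complex.exp (Complex.I * (r : ℂ))).HasTemperateGrowth := by
    refine ⟨(contDiff_const.mul Complex.ofRealCLM.contDiff).cexp, fun n => ⟨0, 1, fun r => ?_⟩⟩
    rw [norm_iteratedFDeriv_eq_norm_iteratedDeriv, hderiv n]
    simp [mul_comm Complex.I, Complex.norm_exp_ofReal_mul_I]
  exact hexp.comp (Function.hasTemperateGrowth_inner_left ξ)

/-- The translation `T_x φ (y) = φ (y - x)`. -/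
noncomputable def translation {d : ℕ} (x : Rd d) (φ : 𝓢(Rd d, ℂ)) : 𝓢(Rd d, ℂ) :=
  SchwartzMap.compSubConstCLM ℂ x φ

/-- The modulation `M_ξ φ (y) = exp (i ⟨y, ξ⟩) φ (y)`. -/
noncomputable def modulation {d : ℕ} (ξ : Rd d) (φ : 𝓢(Rd d, ℂ)) : 𝓢(Rd d, ℂ) :=
  SchwartzMap.smulLeftCLM ℂ (planeWave ξ) φ

/-- Pointwise complex conjugation of a Schwartz function. -/
noncomputable def conjugate {d : ℕ} (φ : 𝓢(Rd d, ℂ)) : 𝓢(Rd d, ℂ) :=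
  SchwartzMap.postcompCLM (𝕜 := ℝ) (Complex.conjCLE : ℂ →L[ℝ] ℂ) φ

@[simp]
theorem translation_apply {d : ℕ} (x : Rd d) (φ : 𝓢(Rd d, ℂ)) (y : Rd d) :
    translation x φ y = φ (y - x) := rfl

@[simp]
theorem modulation_apply {d : ℕ} (ξ : Rd d) (φ : 𝓢(Rd d, ℂ)) (y : Rd d) :
    modulation ξ φ y = planeWave ξ y * φ y := by
  simp [modulation, SchwartzMap.smulLeftCLM_apply_apply (planeWave_hasTemperateGrowth ξ)]

@[simp]
theorem conjugate_apply {d : ℕ} (φ : 𝓢(Rd d, ℂ)) (y : Rd d) :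
    conjugate φ y = starRingEnd ℂ (φ y) := by
  simp [conjugate]

/-- The action `(u, φ)` of a tempered distribution, linear in `u` and conjugate linear in `φ`,
consistent with the `L²` inner product `∫ u(y) conj(φ(y)) dy`. -/
noncomputable def sesqAction {d : ℕ} (u : 𝓢'(Rd d, ℂ)) (φ : 𝓢(Rd d, ℂ)) : ℂ :=
  u (conjugate φ)

/-- The short-time Fourier transform `V_φ u (x, ξ) = (2π)^(-d/2) (u, M_ξ T_x φ)`. -/
noncomputable def stft {d : ℕ} (φ : 𝓢(Rd d, ℂ)) (u : 𝓢'(Rd d, ℂ)) (x ξ : Rd d) : ℂ :=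
  (((2 * Real.pi) ^ (-(d : ℝ) / 2) : ℝ) : ℂ) * sesqAction u (modulation ξ (translation x φ))

/-- The length `|α|` of a multi-index. -/
def multiLength {d : ℕ} (α : Fin d →₀ ℕ) : ℕ := ∑ i, α i

/-- The factorial `α!` of a multi-index. -/
def multiFactorial {d : ℕ} (α : Fin d →₀ ℕ) : ℕ := ∏ i, (α i).factorial

/-- The monomial `x^α`. -/
noncomputable def monomialFn {d : ℕ} (α : Fin d →₀ ℕ) (x : Rd d) : ℝ := ∏ i, x i ^ α i

/-- The operator `D^α = (-i)^|α| ∂_1^(α_1) ⋯ ∂_d^(α_d)`, on Schwartz functions and on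
tempered distributions alike. -/
noncomputable def multiD {d : ℕ} {V : Type*} [SMul ℂ V] [LineDeriv (Rd d) V V]
    (α : Fin d →₀ ℕ) (f : V) : V :=
  (-Complex.I) ^ multiLength α •
    (List.finRange d).foldr
      (fun i g => (fun w : V => ∂_{(EuclideanSpace.single i (1 : ℝ) : Rd d)} w)^[α i] g) f

/-- Membership in the Beurling type Gelfand--Shilov space `Σ_t^s(ℝ^d)`: for every `h > 0`,
`sup |x^α D^β f(x)| / (h^|α+β| α!^t β!^s) < ∞`, the supremum over all `x`, `α`, `β`.
(Smooth functions with this property are Schwartz functions.) -/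
def IsGelfandShilov {d : ℕ} (t s : ℝ) (f : 𝓢(Rd d, ℂ)) : Prop :=
  ∀ h : ℝ, 0 < h → ∃ C : ℝ, ∀ (α β : Fin d →₀ ℕ) (x : Rd d),
    ‖(monomialFn α x : ℂ) * multiD β f x‖ /
      (h ^ multiLength (α + β) * (multiFactorial α : ℝ) ^ t * (multiFactorial β : ℝ) ^ s) ≤ C

/-- The phase space `T*ℝ^d`, with points `(x, ξ)`. -/
abbrev PhaseSpace (d : ℕ) := Rd d × Rd d

/-- The bracket `⟨z⟩ = (1 + |x|² + |ξ|²)^(1/2)` of `z = (x, ξ)`. -/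
noncomputable def bracket {d : ℕ} (z : PhaseSpace d) : ℝ :=
  Real.sqrt (1 + ‖z.1‖ ^ 2 + ‖z.2‖ ^ 2)

/-- The Gabor wave front set, computed with the window `φ`: the points `z₀ ≠ 0` of phase space
without an open conic neighbourhood `Γ` in `T*ℝ^d ∖ 0` in which `V_φ u` decays rapidly. -/
def gaborWF {d : ℕ} (φ : 𝓢(Rd d, ℂ)) (u : 𝓢'(Rd d, ℂ)) : Set (PhaseSpace d) :=
  {z₀ | z₀ ≠ 0 ∧ ¬ ∃ Γ : Set (PhaseSpace d), IsOpen Γ ∧ (0 : PhaseSpace d) ∉ Γ ∧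
    (∀ z ∈ Γ, ∀ a : ℝ, 0 < a → a • z ∈ Γ) ∧ z₀ ∈ Γ ∧
    ∀ N : ℕ, ∃ C : ℝ, ∀ z ∈ Γ, bracket z ^ N * ‖stft φ u z.1 z.2‖ ≤ C}

/-- The `t,s`-Gelfand--Shilov wave front set of a tempered distribution, computed with the window
`ψ`: the points `z₀ ≠ 0` of phase space without an open neighbourhood `U` in `T*ℝ^d ∖ 0` such that
`sup exp(r λ) |V_ψ u (λ^t x, λ^s ξ)| < ∞` for all `r > 0`, the supremum over `λ > 0` and
`(x, ξ) ∈ U`. -/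
def gelfandShilovWF {d : ℕ} (t s : ℝ) (ψ : 𝓢(Rd d, ℂ)) (u : 𝓢'(Rd d, ℂ)) :
    Set (PhaseSpace d) :=
  {z₀ | z₀ ≠ 0 ∧ ¬ ∃ U : Set (PhaseSpace d), IsOpen U ∧ (0 : PhaseSpace d) ∉ U ∧ z₀ ∈ U ∧
    ∀ r : ℝ, 0 < r → ∃ C : ℝ, ∀ a : ℝ, 0 < a → ∀ z ∈ U,
      Real.exp (r * a) * ‖stft ψ u (a ^ t • z.1) (a ^ s • z.2)‖ ≤ C}

/-- The polynomial function `x ↦ p(x)` on `ℝ^d`. -/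
noncomputable def polyFn {d : ℕ} (p : MvPolynomial (Fin d) ℂ) (x : Rd d) : ℂ :=
  MvPolynomial.eval (fun i => (x i : ℂ)) p

theorem polyFn_hasTemperateGrowth {d : ℕ} (p : MvPolynomial (Fin d) ℂ) :
    (polyFn p).HasTemperateGrowth := by
  induction p using MvPolynomial.induction_on with
  | C a =>
    have : polyFn (d := d) (MvPolynomial.C a) = fun _ => a := by ext x; simp [polyFn]
    rw [this]; exact Function.HasTemperateGrowth.const a
  | add p q hp hq =>
    have : polyFn (p + q) = polyFn p + polyFn q := by ext x; simp [polyFn]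
    rw [this]; exact hp.add hq
  | mul_X p i hp =>
    have : polyFn (p * MvPolynomial.X i) =
        polyFn p * (fun x : Rd d => ((EuclideanSpace.proj (𝕜 := ℝ) i x : ℝ) : ℂ)) := by
      ext x; simp [polyFn]
    rw [this]
    exact hp.mul (ContinuousLinearMap.hasTemperateGrowth
      (Complex.ofRealCLM ∘L (EuclideanSpace.proj (𝕜 := ℝ) i : Rd d →L[ℝ] ℝ)))

/-- The polynomial `p` as a tempered distribution, `φ ↦ ∫ p(x) φ(x) dx`. -/
noncomputable def polyDistribution {d : ℕ} (p : MvPolynomial (Fin d) ℂ) : 𝓢'(Rd d, ℂ) :=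
  Function.HasTemperateGrowth.toTemperedDistribution MeasureTheory.volume
    (polyFn_hasTemperateGrowth p)

/-- The distribution `p(D) δ_0 = ∑ c_α D^α δ_0` for `p(x) = ∑ c_α x^α`. -/
noncomputable def diracCombination {d : ℕ} (p : MvPolynomial (Fin d) ℂ) : 𝓢'(Rd d, ℂ) :=
  ∑ α ∈ p.support, p.coeff α • multiD α (TemperedDistribution.delta (0 : Rd d))

end AnisotropicWF

open scoped SchwartzMap LineDeriv FourierTransform
open Filter Topology MeasureTheory

namespace AnisotropicWF

/-! For both distributions the modulus of the short-time Fourier transform is that of a polynomial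
in one phase space variable whose coefficients decay in the other. For `p(D) δ_0`, evaluation at `0`
leaves a polynomial in `ξ` whose coefficients are combinations of derivatives of the conjugate
window at `-x` (`stft_diracCombination`). For `p`, the substitution `y ↦ y + x` gives a phase times
a polynomial in `x` whose coefficients are combinations of Fourier transforms of `y^β` times the
conjugate window (`stft_polyDistribution`). Exchanging `x` and `ξ`, and with them `t` and `s`,
brings the second case to the shape of the first.

For functions of this shape the singular set is read off in `conicSingularSet_eq` and
`anisotropicSingularSet_eq`. Near a point with `x ≠ 0` the decay of the coefficients beats the
polynomial growth in `ξ`. Near `(0, ξ)` with `ξ ≠ 0`, fix `x₀` for which the polynomial in `ξ` is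
nonzero and perturb `ξ` to a point where it does not vanish. Any cone, or family of anisotropic
dilates, about `(0, ξ)` contains `(x₀, aξ)`, respectively `(x₀, a^s ξ)`, for large `a`. Decay there
would force a polynomial to tend to zero along a ray on which it is not identically zero.

The polynomials are built by `shiftPoly`, from products of operators `T i + κ ξ i`. Their top-degree
coefficients show that they are nonzero (`sum_shiftPoly_ne_zero`). Superexponential decay of the
coefficients comes from the Gelfand–Shilov estimates, by summing an exponential series
(`exists_exp_mul_le_of_forall_pow_mul_le`). -/

/-! ### Singular sets of functions on phase space, and the exchange of variables -/

/-- The set of nonzero points of phase space near which a function `V` of `(x, ξ)` does not decay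
rapidly along an open cone. -/
def conicSingularSet {d : ℕ} (V : Rd d → Rd d → ℂ) : Set (PhaseSpace d) :=
  {z₀ | z₀ ≠ 0 ∧ ¬ ∃ Γ : Set (PhaseSpace d), IsOpen Γ ∧ (0 : PhaseSpace d) ∉ Γ ∧
    (∀ z ∈ Γ, ∀ a : ℝ, 0 < a → a • z ∈ Γ) ∧ z₀ ∈ Γ ∧
    ∀ N : ℕ, ∃ C : ℝ, ∀ z ∈ Γ, bracket z ^ N * ‖V z.1 z.2‖ ≤ C}

/-- The set of nonzero points of phase space near which a function `V` of `(x, ξ)` does not decay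
superexponentially along the curves `a ↦ (a ^ t x, a ^ s ξ)`. -/
def anisotropicSingularSet {d : ℕ} (t s : ℝ) (V : Rd d → Rd d → ℂ) : Set (PhaseSpace d) :=
  {z₀ | z₀ ≠ 0 ∧ ¬ ∃ U : Set (PhaseSpace d), IsOpen U ∧ (0 : PhaseSpace d) ∉ U ∧ z₀ ∈ U ∧
    ∀ r : ℝ, 0 < r → ∃ C : ℝ, ∀ a : ℝ, 0 < a → ∀ z ∈ U,
      Real.exp (r * a) * ‖V (a ^ t • z.1) (a ^ s • z.2)‖ ≤ C}

theorem gaborWF_eq_conicSingularSet {d : ℕ} (φ : 𝓢(Rd d, ℂ)) (u : 𝓢'(Rd d, ℂ)) :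
    gaborWF φ u = conicSingularSet (stft φ u) := rfl

theorem gelfandShilovWF_eq_anisotropicSingularSet {d : ℕ} (t s : ℝ) (ψ : 𝓢(Rd d, ℂ))
    (u : 𝓢'(Rd d, ℂ)) :
    gelfandShilovWF t s ψ u = anisotropicSingularSet t s (stft ψ u) := rfl

theorem bracket_swap {d : ℕ} (z : PhaseSpace d) : bracket z.swap = bracket z := by
  simp only [bracket, Prod.fst_swap, Prod.snd_swap]
  congr 1
  ring

theorem swap_ne_zero_iff {d : ℕ} (z : PhaseSpace d) : z.swap ≠ 0 ↔ z ≠ 0 := by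
  simp [Prod.ext_iff, and_comm]

theorem preimage_swap_conicSingularSet_subset {d : ℕ} (V : Rd d → Rd d → ℂ) :
    Prod.swap ⁻¹' conicSingularSet (fun ξ x => V x ξ) ⊆ conicSingularSet V := by
  rintro z ⟨hz, h⟩
  refine ⟨(swap_ne_zero_iff z).1 hz, fun ⟨Γ, hΓ, h0, hc, hzΓ, hb⟩ => h ?_⟩
  refine ⟨Prod.swap ⁻¹' Γ, hΓ.preimage continuous_swap, by simpa using h0,
    fun w hw a ha => hc _ hw a ha, by simpa using hzΓ, fun N => ?_⟩
  obtain ⟨C, hC⟩ := hb N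
  exact ⟨C, fun w hw => by simpa [bracket_swap] using hC _ hw⟩

theorem conicSingularSet_flip {d : ℕ} (V : Rd d → Rd d → ℂ) :
    conicSingularSet V = Prod.swap ⁻¹' conicSingularSet (fun ξ x => V x ξ) := by
  refine Set.Subset.antisymm (fun z hz => ?_) (preimage_swap_conicSingularSet_subset V)
  exact preimage_swap_conicSingularSet_subset (fun ξ x => V x ξ) (by simpa using hz)

theorem preimage_swap_anisotropicSingularSet_subset {d : ℕ} (t s : ℝ) (V : Rd d → Rd d → ℂ) :
    Prod.swap ⁻¹' anisotropicSingularSet s t (fun ξ x => V x ξ) ⊆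
      anisotropicSingularSet t s V := by
  rintro z ⟨hz, h⟩
  refine ⟨(swap_ne_zero_iff z).1 hz, fun ⟨U, hU, h0, hzU, hb⟩ => h ?_⟩
  refine ⟨Prod.swap ⁻¹' U, hU.preimage continuous_swap, by simpa using h0,
    by simpa using hzU, fun r hr => ?_⟩
  obtain ⟨C, hC⟩ := hb r hr
  exact ⟨C, fun a ha w hw => hC a ha _ hw⟩

/-- The exponents travel with their variables, so `t` and `s` change places. One inclusion suffices,
since flipping twice is the identity. -/
theorem anisotropicSingularSet_flip {d : ℕ} (t s : ℝ) (V : Rd d → Rd d → ℂ) :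
    anisotropicSingularSet t s V =
      Prod.swap ⁻¹' anisotropicSingularSet s t (fun ξ x => V x ξ) := by
  refine Set.Subset.antisymm (fun z hz => ?_) (preimage_swap_anisotropicSingularSet_subset t s V)
  exact preimage_swap_anisotropicSingularSet_subset s t (fun ξ x => V x ξ) (by simpa using hz)

/-! ### Polynomials on balls and along rays -/

/-- A nonzero polynomial does not vanish identically on a ball. -/
theorem exists_polyFn_ne_zero {d : ℕ} {p : MvPolynomial (Fin d) ℂ} (hp : p ≠ 0) (x : Rd d)
    {ε : ℝ} (hε : 0 < ε) : ∃ y, ‖y - x‖ < ε ∧ polyFn p y ≠ 0 := by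
  by_contra! h
  have hopen : IsOpen {w : Fin d → ℝ | ‖(WithLp.toLp 2 w : Rd d) - x‖ < ε} := by
    refine isOpen_lt (Continuous.norm (Continuous.sub ?_ continuous_const)) continuous_const
    exact PiLp.continuous_toLp 2 _
  have hx : (WithLp.ofLp x) ∈ {w : Fin d → ℝ | ‖(WithLp.toLp 2 w : Rd d) - x‖ < ε} := by
    simpa using hε
  obtain ⟨δ, hδ, hball⟩ := Metric.isOpen_iff.1 hopen _ hx
  -- The ball contains a product of real intervals, and a complex polynomial vanishing on a product
  -- of infinite sets is zero.
  refine hp (MvPolynomial.funext_set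
    (fun i => (fun r : ℝ => (r : ℂ)) '' Set.Ioo (x i - δ / 2) (x i + δ / 2))
    (fun i => ((Set.Ioo_infinite (by linarith)).image
      Complex.ofReal_injective.injOn)) fun z hz => ?_)
  choose w hw hwz using fun i => hz i (Set.mem_univ i)
  have hmem : w ∈ Metric.ball (WithLp.ofLp x) δ := by
    rw [Metric.mem_ball]
    refine lt_of_le_of_lt ((dist_pi_le_iff (by positivity : (0 : ℝ) ≤ δ / 2)).2 fun i => ?_)
      (by linarith : δ / 2 < δ)
    rw [Real.dist_eq, abs_le]
    constructor <;> linarith [(hw i).1, (hw i).2]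
  have := h _ (hball hmem)
  simp only [polyFn] at this
  rw [map_zero, ← this]
  congr 2
  ext i
  simp [← hwz]

/-- A polynomial does not tend to zero along a ray that contains a point where it is nonzero. -/
theorem not_tendsto_polyFn_smul {d : ℕ} {p : MvPolynomial (Fin d) ℂ} {ξ : Rd d}
    (h : polyFn p ξ ≠ 0) : ¬ Tendsto (fun a : ℝ => polyFn p (a • ξ)) atTop (𝓝 0) := by
  intro hlim
  -- The restriction to the ray is a polynomial in one variable: if nonconstant it is unbounded, and
  -- if constant it keeps its nonzero value at `1`.
  set R : Polynomial ℂ :=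
    MvPolynomial.aeval (fun i => Polynomial.C (ξ i : ℂ) * Polynomial.X) p with hR
  have hev : ∀ a : ℝ, R.eval (a : ℂ) = polyFn p (a • ξ) := by
    intro a
    rw [hR, ← Polynomial.coe_aeval_eq_eval, MvPolynomial.comp_aeval_apply, polyFn,
      MvPolynomial.aeval_eq_eval]
    refine congrArg (fun f => MvPolynomial.eval f p) (funext fun i => ?_)
    rw [map_mul, Polynomial.aeval_C, Polynomial.aeval_X, PiLp.smul_apply, smul_eq_mul,
      Complex.ofReal_mul, mul_comm]
    rfl
  have hone : R.eval ((1 : ℝ) : ℂ) ≠ 0 := by rw [hev, one_smul]; exact h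
  simp_rw [← hev] at hlim
  by_cases hdeg : 0 < R.degree
  · have hz : Tendsto (fun a : ℝ => ‖(a : ℂ)‖) atTop atTop := by
      simpa using tendsto_abs_atTop_atTop
    exact not_tendsto_atTop_of_tendsto_nhds hlim.norm (R.tendsto_norm_atTop hdeg hz)
  · rw [Polynomial.eq_C_of_degree_le_zero (not_lt.1 hdeg)] at hlim hone
    simp only [Polynomial.eval_C] at hlim hone
    exact hone (tendsto_nhds_unique tendsto_const_nhds hlim)

theorem bracket_le {d : ℕ} (z : PhaseSpace d) : bracket z ≤ 1 + ‖z.1‖ + ‖z.2‖ := by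
  refine Real.sqrt_le_iff.2 ⟨by positivity, ?_⟩
  nlinarith [norm_nonneg z.1, norm_nonneg z.2, mul_nonneg (norm_nonneg z.1) (norm_nonneg z.2)]

theorem norm_snd_le_bracket {d : ℕ} (z : PhaseSpace d) : ‖z.2‖ ≤ bracket z := by
  refine Real.le_sqrt_of_sq_le ?_
  nlinarith [sq_nonneg ‖z.1‖]

theorem exists_mem_polyFn_ne_zero {d : ℕ} {p : MvPolynomial (Fin d) ℂ} (hp : p ≠ 0)
    {U : Set (PhaseSpace d)} (hU : IsOpen U) {x ξ : Rd d} (h : (x, ξ) ∈ U) :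
    ∃ η, (x, η) ∈ U ∧ polyFn p η ≠ 0 := by
  obtain ⟨ε, hε, hball⟩ := Metric.isOpen_iff.1
    (hU.preimage (Continuous.prodMk_right x)) ξ h
  obtain ⟨η, hη, hne⟩ := exists_polyFn_ne_zero hp ξ hε
  exact ⟨η, hball (by rwa [Metric.mem_ball, dist_eq_norm]), hne⟩

/-! ### Singular sets of polynomials with decaying coefficients -/

/-- Let `V x ξ` be, up to a unimodular factor, a polynomial in `ξ` whose coefficients decay rapidly
in `x`. Then it decays rapidly exactly away from the directions `(0, ξ)`. -/
theorem conicSingularSet_eq {d : ℕ} {V : Rd d → Rd d → ℂ} {q : Rd d → MvPolynomial (Fin d) ℂ}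
    (hV : ∀ x ξ, ‖V x ξ‖ = ‖polyFn (q x) ξ‖) (hq : ∃ x, q x ≠ 0) (m : ℕ)
    (hdec : ∀ N : ℕ, ∃ C : ℝ, ∀ x ξ, (1 + ‖x‖) ^ N * ‖polyFn (q x) ξ‖ ≤ C * (1 + ‖ξ‖) ^ m) :
    conicSingularSet V = {z | z.1 = 0 ∧ z.2 ≠ 0} := by
  ext z
  constructor
  · rintro ⟨hz, h⟩
    have hz1 : z.1 = 0 := by
      by_contra hx
      have hxpos : 0 < ‖z.1‖ := norm_pos_iff.2 hx
      -- This slope puts `z` strictly inside the cone `‖ξ‖ < M ‖x‖`, where powers of `1 + ‖ξ‖` are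
      -- controlled by powers of `1 + ‖x‖`.
      set M : ℝ := (‖z.2‖ + 1) / ‖z.1‖ with hM
      have hMpos : 0 < M := by positivity
      refine h ⟨{w | ‖w.2‖ < M * ‖w.1‖}, isOpen_lt (by fun_prop) (by fun_prop), by simp,
        fun w hw a ha => ?_, ?_, fun N => ?_⟩
      · simp only [Set.mem_ofPred_eq, Prod.smul_fst, Prod.smul_snd, norm_smul, Real.norm_eq_abs,
          abs_of_pos ha] at hw ⊢
        nlinarith
      · simp only [Set.mem_ofPred_eq, hM]
        rw [div_mul_cancel₀ _ hxpos.ne']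
        linarith
      -- The `m` additional powers pay for the growth of degree `m` in `ξ`.
      · obtain ⟨C, hC⟩ := hdec (N + m)
        refine ⟨(1 + M) ^ N * (C * (1 + M) ^ m), fun w hw => ?_⟩
        simp only [Set.mem_ofPred_eq] at hw
        have hA : 0 < 1 + ‖w.1‖ := by positivity
        have hb : bracket w ≤ (1 + M) * (1 + ‖w.1‖) := by
          nlinarith [bracket_le w, norm_nonneg w.1]
        have hξ : 1 + ‖w.2‖ ≤ (1 + M) * (1 + ‖w.1‖) := by nlinarith [norm_nonneg w.1]
        have hCnn : 0 ≤ C := by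
          have h0 := hC 0 0
          simp only [norm_zero, add_zero, one_pow, one_mul, mul_one] at h0
          exact (norm_nonneg _).trans h0
        have key : (1 + ‖w.1‖) ^ N * ‖polyFn (q w.1) w.2‖ ≤ C * (1 + M) ^ m := by
          have h1 : (1 + ‖w.1‖) ^ (N + m) * ‖polyFn (q w.1) w.2‖ ≤
              C * ((1 + M) * (1 + ‖w.1‖)) ^ m := by
            refine (hC w.1 w.2).trans ?_
            gcongr
          rw [mul_pow, pow_add] at h1
          have hAm : 0 < (1 + ‖w.1‖) ^ m := by positivity
          refine le_of_mul_le_mul_right ?_ hAm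
          linarith
        rw [hV]
        calc bracket w ^ N * ‖polyFn (q w.1) w.2‖
            ≤ ((1 + M) * (1 + ‖w.1‖)) ^ N * ‖polyFn (q w.1) w.2‖ := by
              gcongr
              exact Real.sqrt_nonneg _
          _ = (1 + M) ^ N * ((1 + ‖w.1‖) ^ N * ‖polyFn (q w.1) w.2‖) := by
              rw [mul_pow, mul_assoc]
          _ ≤ _ := by gcongr
    exact ⟨hz1, fun h2 => hz (Prod.ext hz1 h2)⟩
  · rintro ⟨hz1, hz2⟩
    refine ⟨fun h => hz2 (by rw [h]; rfl), ?_⟩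
    rintro ⟨Γ, hΓ, h0, hcone, hzΓ, hb⟩
    obtain ⟨x, hx⟩ := hq
    obtain ⟨ξ, hξΓ, hξ⟩ := exists_mem_polyFn_ne_zero hx hΓ
      (show ((0 : Rd d), z.2) ∈ Γ by rw [← hz1]; exact hzΓ)
    have hξ0 : ξ ≠ 0 := fun h => h0 (by rw [h] at hξΓ; exact hξΓ)
    have hξpos : 0 < ‖ξ‖ := norm_pos_iff.2 hξ0
    obtain ⟨C, hC⟩ := hb 1
    -- Dilating `(a⁻¹ • x, ξ)` by `a` gives `(x, a • ξ)`, so the cone eventually contains the ray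
    -- over the fixed `x`. A single power of the bracket already yields decay.
    have hlim : Tendsto (fun a : ℝ => (a⁻¹ • x, ξ)) atTop (𝓝 ((0 : Rd d), ξ)) := by
      refine Tendsto.prodMk_nhds ?_ tendsto_const_nhds
      simpa using (tendsto_inv_atTop_zero (𝕜 := ℝ)).smul_const x
    refine not_tendsto_polyFn_smul hξ ?_
    have hC0 : Tendsto (fun a : ℝ => C / ‖ξ‖ * a⁻¹) atTop (𝓝 0) := by
      simpa using tendsto_inv_atTop_zero.const_mul (C / ‖ξ‖)
    refine squeeze_zero_norm' ?_ hC0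
    filter_upwards [hlim (hΓ.mem_nhds hξΓ), eventually_gt_atTop 0] with a ha hapos
    have hmem : (x, a • ξ) ∈ Γ := by
      have := hcone _ ha a hapos
      rwa [Prod.smul_mk, smul_inv_smul₀ hapos.ne'] at this
    have h1 := hC _ hmem
    rw [pow_one, hV] at h1
    have h2 : a * ‖ξ‖ ≤ bracket (x, a • ξ) := by
      refine le_trans (le_of_eq ?_) (norm_snd_le_bracket _)
      simp [norm_smul, abs_of_pos hapos]
    have h3 : a * ‖ξ‖ * ‖polyFn (q x) (a • ξ)‖ ≤ C :=
      (mul_le_mul_of_nonneg_right h2 (norm_nonneg _)).trans h1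
    rw [← div_eq_mul_inv, div_div, le_div_iff₀ (by positivity)]
    linarith

/-- On the positive half line, powers are dominated by exponentials. -/
theorem exists_one_add_rpow_mul_pow_le {s : ℝ} (hs : 0 < s) {K : ℝ} (hK : 0 ≤ K) (m : ℕ) :
    ∃ C : ℝ, 0 ≤ C ∧ ∀ a : ℝ, 0 < a → (1 + a ^ s * K) ^ m ≤ C * Real.exp a := by
  -- Chosen so that `exp (ε a) ^ s = exp (a / (m + 1))`, whose `m`-th power is at most `exp a`;
  -- using `m + 1` covers `m = 0`.
  set ε : ℝ := 1 / (s * (m + 1)) with hε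
  have hεpos : 0 < ε := by positivity
  refine ⟨(1 + (ε⁻¹) ^ s * K) ^ m, by positivity, fun a ha => ?_⟩
  have h1 : a ^ s ≤ (ε⁻¹) ^ s * Real.exp (a / (m + 1)) := by
    have h2 : a ≤ ε⁻¹ * Real.exp (ε * a) := by
      rw [inv_mul_eq_div, le_div_iff₀ hεpos]
      linarith [Real.add_one_le_exp (ε * a)]
    calc a ^ s ≤ (ε⁻¹ * Real.exp (ε * a)) ^ s := Real.rpow_le_rpow ha.le h2 hs.le
      _ = (ε⁻¹) ^ s * Real.exp (a / (m + 1)) := by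
        rw [Real.mul_rpow (by positivity) (by positivity), ← Real.exp_mul]
        congr 2
        rw [hε]
        field_simp
  have h3 : 1 + a ^ s * K ≤ (1 + (ε⁻¹) ^ s * K) * Real.exp (a / (m + 1)) := by
    have : 1 ≤ Real.exp (a / (m + 1)) := Real.one_le_exp (by positivity)
    nlinarith [mul_le_mul_of_nonneg_right h1 hK]
  calc (1 + a ^ s * K) ^ m ≤ ((1 + (ε⁻¹) ^ s * K) * Real.exp (a / (m + 1))) ^ m := by gcongr
    _ = (1 + (ε⁻¹) ^ s * K) ^ m * Real.exp (m * (a / (m + 1))) := by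
      rw [mul_pow, ← Real.exp_nat_mul]
    _ ≤ _ := by
      gcongr
      rw [mul_div_assoc', div_le_iff₀ (by positivity)]
      nlinarith

/-- Let `V x ξ` be, up to a unimodular factor, a polynomial in `ξ` whose coefficients decay
superexponentially in `x`. Then it decays superexponentially exactly away from the
directions `(0, ξ)`. -/
theorem anisotropicSingularSet_eq {d : ℕ} {t s : ℝ} (ht : 0 < t) (hs : 0 < s)
    {V : Rd d → Rd d → ℂ} {q : Rd d → MvPolynomial (Fin d) ℂ}
    (hV : ∀ x ξ, ‖V x ξ‖ = ‖polyFn (q x) ξ‖) (hq : ∃ x, q x ≠ 0) (m : ℕ)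
    (hdec : ∀ j : Fin d, ∀ r : ℝ, 0 < r → ∃ C : ℝ, ∀ x ξ,
      Real.exp (r * |x j| ^ (1 / t)) * ‖polyFn (q x) ξ‖ ≤ C * (1 + ‖ξ‖) ^ m) :
    anisotropicSingularSet t s V = {z | z.1 = 0 ∧ z.2 ≠ 0} := by
  ext z
  constructor
  · rintro ⟨hz, h⟩
    have hz1 : z.1 = 0 := by
      by_contra hx
      obtain ⟨j, hj⟩ : ∃ j, z.1 j ≠ 0 := by
        by_contra! hall
        exact hx (by ext j; simpa using hall j)
      set δ : ℝ := |z.1 j| / 2 with hδ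
      have hδpos : 0 < δ := by positivity
      set K : ℝ := ‖z.2‖ + 1 with hK
      refine h ⟨{w | δ < |w.1 j| ∧ ‖w.2‖ < K}, ?_, ?_, ?_, fun r hr => ?_⟩
      · exact IsOpen.inter
          (isOpen_lt (f := fun _ : PhaseSpace d => δ) (g := fun w => |w.1 j|) (by fun_prop)
            (by fun_prop))
          (isOpen_lt (f := fun w : PhaseSpace d => ‖w.2‖) (g := fun _ => K) (by fun_prop)
            (by fun_prop))
      · simp [hδpos.le]
      · simp only [Set.mem_ofPred_eq, hδ, hK]
        exact ⟨half_lt_self (abs_pos.2 hj), by linarith⟩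
      -- On the curve `|a^t x_j|^(1/t) = a |x_j|^(1/t) ≥ a δ^(1/t)`, so this rate yields `exp ((r +
      -- 1) a)`. The surplus `exp a` absorbs the polynomial growth in `ξ`.
      · obtain ⟨C, hC⟩ := hdec j ((r + 1) / δ ^ (1 / t)) (by positivity)
        obtain ⟨C', hC'nn, hC'⟩ := exists_one_add_rpow_mul_pow_le hs
          (show 0 ≤ K by positivity) m
        have hCnn : 0 ≤ C := by
          have h0 := hC 0 0
          simp only [norm_zero, add_zero, one_pow, mul_one] at h0
          exact le_trans (by positivity) h0
        refine ⟨C * C', fun a ha w hw => ?_⟩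
        have has : 0 < a ^ s := Real.rpow_pos_of_pos ha s
        have hat : 0 < a ^ t := Real.rpow_pos_of_pos ha t
        have hxw : (r + 1) * a ≤
            (r + 1) / δ ^ (1 / t) * |(a ^ t • w.1) j| ^ (1 / t) := by
          have e1 : |(a ^ t • w.1) j| ^ (1 / t) = a * |w.1 j| ^ (1 / t) := by
            rw [PiLp.smul_apply, smul_eq_mul, abs_mul, abs_of_pos hat,
              Real.mul_rpow hat.le (abs_nonneg _), ← Real.rpow_mul ha.le,
              mul_one_div_cancel ht.ne', Real.rpow_one]
          have e2 : δ ^ (1 / t) ≤ |w.1 j| ^ (1 / t) :=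
            Real.rpow_le_rpow hδpos.le hw.1.le (by positivity)
          have hδt : 0 < δ ^ (1 / t) := by positivity
          rw [e1, div_mul_eq_mul_div, le_div_iff₀ hδt]
          nlinarith [mul_le_mul_of_nonneg_left e2 (by positivity : 0 ≤ (r + 1) * a)]
        have h1 := hC (a ^ t • w.1) (a ^ s • w.2)
        have h2 : (1 + ‖a ^ s • w.2‖) ^ m ≤ C' * Real.exp a := by
          refine le_trans ?_ (hC' a ha)
          rw [norm_smul, Real.norm_eq_abs, abs_of_pos has]
          gcongr
          exact hw.2.le
        rw [hV]
        have h3 : Real.exp ((r + 1) * a) * ‖polyFn (q (a ^ t • w.1)) (a ^ s • w.2)‖ ≤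
            C * C' * Real.exp a :=
          calc _ ≤ _ := mul_le_mul_of_nonneg_right (Real.exp_le_exp.2 hxw) (norm_nonneg _)
            _ ≤ _ := h1
            _ ≤ C * (C' * Real.exp a) := by gcongr
            _ = _ := by ring
        refine le_of_mul_le_mul_right ?_ (Real.exp_pos a)
        rw [add_mul, one_mul, Real.exp_add] at h3
        linarith
    exact ⟨hz1, fun h2 => hz (Prod.ext hz1 h2)⟩
  · rintro ⟨hz1, hz2⟩
    refine ⟨fun h => hz2 (by rw [h]; rfl), ?_⟩
    rintro ⟨U, hU, h0, hzU, hb⟩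
    obtain ⟨x, hx⟩ := hq
    obtain ⟨ξ, hξU, hξ⟩ := exists_mem_polyFn_ne_zero hx hU
      (show ((0 : Rd d), z.2) ∈ U by rw [← hz1]; exact hzU)
    obtain ⟨C, hC⟩ := hb 1 one_pos
    have hlim : Tendsto (fun a : ℝ => (a ^ (-t) • x, ξ)) atTop (𝓝 ((0 : Rd d), ξ)) := by
      refine Tendsto.prodMk_nhds ?_ tendsto_const_nhds
      simpa using (tendsto_rpow_neg_atTop ht).smul_const x
    have hdecay : Tendsto (fun a : ℝ => polyFn (q x) (a ^ s • ξ)) atTop (𝓝 0) := by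
      have hC0 : Tendsto (fun a : ℝ => C * Real.exp (-a)) atTop (𝓝 0) := by
        simpa using Real.tendsto_exp_neg_atTop_nhds_zero.const_mul C
      refine squeeze_zero_norm' ?_ hC0
      filter_upwards [hlim (hU.mem_nhds hξU), eventually_gt_atTop 0] with a ha hapos
      have h1 := hC a hapos _ ha
      simp only [smul_smul, ← Real.rpow_add hapos, add_neg_cancel, Real.rpow_zero, one_smul,
        one_mul, hV] at h1
      rw [Real.exp_neg, ← div_eq_mul_inv, le_div_iff₀ (Real.exp_pos a)]
      linarith
    refine not_tendsto_polyFn_smul hξ ?_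
    -- Replacing `a` by `a^(1/s)` turns the curve `a^s • ξ` into a ray.
    refine (hdecay.comp (tendsto_rpow_atTop (one_div_pos.2 hs))).congr' ?_
    filter_upwards [eventually_gt_atTop 0] with a ha
    simp only [Function.comp_apply]
    rw [← Real.rpow_mul ha.le, one_div_mul_cancel hs.ne', Real.rpow_one]

/-! ### Multi-indices as lists, and the polynomials `shiftPoly` -/

/-- The multi-index that counts the entries of a list. -/
noncomputable def listIndex {d : ℕ} (L : List (Fin d)) : Fin d →₀ ℕ :=
  (L.map fun i => Finsupp.single i 1).sum

/-- The sorted list in which each `i` occurs `α i` times. -/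
def indexList {d : ℕ} (α : Fin d →₀ ℕ) : List (Fin d) :=
  (List.finRange d).flatMap fun i => List.replicate (α i) i

@[simp]
theorem listIndex_nil {d : ℕ} : listIndex ([] : List (Fin d)) = 0 := rfl

@[simp]
theorem listIndex_cons {d : ℕ} (i : Fin d) (L : List (Fin d)) :
    listIndex (i :: L) = Finsupp.single i 1 + listIndex L := by
  simp [listIndex]

theorem degree_listIndex {d : ℕ} (L : List (Fin d)) : (listIndex L).degree = L.length := by
  induction L with
  | nil => simp
  | cons i L ih => simp [ih, Finsupp.degree_single, add_comm]

theorem listIndex_append {d : ℕ} (L M : List (Fin d)) :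
    listIndex (L ++ M) = listIndex L + listIndex M := by
  simp [listIndex]

theorem listIndex_replicate {d : ℕ} (n : ℕ) (i : Fin d) :
    listIndex (List.replicate n i) = Finsupp.single i n := by
  simp [listIndex]

theorem listIndex_indexList {d : ℕ} (α : Fin d →₀ ℕ) : listIndex (indexList α) = α := by
  have h : ∀ L : List (Fin d), listIndex (L.flatMap fun i => List.replicate (α i) i) =
      (L.map fun i => Finsupp.single i (α i)).sum := by
    intro L
    induction L with
    | nil => simp
    | cons i L ih =>
      rw [List.flatMap_cons, listIndex_append, ih, listIndex_replicate, List.map_cons,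
        List.sum_cons]
  rw [indexList, h, ← List.ofFn_eq_map, List.sum_ofFn, Finsupp.univ_sum_single]

theorem length_indexList {d : ℕ} (α : Fin d →₀ ℕ) : (indexList α).length = α.degree := by
  rw [← degree_listIndex, listIndex_indexList]

/-- The polynomial `ev (∏ (T i + κ X i) f)`, the product running over a list of indices. -/
noncomputable def shiftPoly {d : ℕ} {E : Type*} (T : Fin d → E → E) (κ : ℂ) (ev : E → ℂ) :
    List (Fin d) → E → MvPolynomial (Fin d) ℂ
  | [], f => MvPolynomial.C (ev f)
  | i :: L, f => shiftPoly T κ ev L (T i f) +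
      MvPolynomial.C κ * (MvPolynomial.X i * shiftPoly T κ ev L f)

section

variable {d : ℕ} {E : Type*} {T : Fin d → E → E} {κ : ℂ}

/-- Only the choice of `κ X i` in every factor reaches degree `L.length`; any factor `T i` lowers
the degree. -/
theorem coeff_shiftPoly {ev : E → ℂ} (L : List (Fin d)) (f : E) (β : Fin d →₀ ℕ)
    (hβ : L.length ≤ β.degree) :
    (shiftPoly T κ ev L f).coeff β = if β = listIndex L then κ ^ L.length * ev f else 0 := by
  induction L generalizing f β with
  | nil => simp [shiftPoly, MvPolynomial.coeff_C, eq_comm]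
  | cons i L ih =>
    rw [List.length_cons] at hβ
    have hne : β ≠ listIndex L := by
      rintro rfl
      rw [degree_listIndex] at hβ
      omega
    rw [shiftPoly, MvPolynomial.coeff_add, ih _ β (by omega), if_neg hne, zero_add,
      MvPolynomial.coeff_C_mul, MvPolynomial.coeff_X_mul']
    by_cases hi : i ∈ β.support
    · have hle : Finsupp.single i 1 ≤ β := by
        rw [Finsupp.single_le_iff]
        exact Nat.one_le_iff_ne_zero.2 (Finsupp.mem_support_iff.1 hi)
      obtain ⟨γ, rfl⟩ := exists_add_of_le hle
      rw [map_add, Finsupp.degree_single] at hβ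
      rw [if_pos hi, add_tsub_cancel_left, ih _ γ (by omega), listIndex_cons]
      by_cases hγ : γ = listIndex L
      · simp [hγ, pow_succ, mul_comm, mul_left_comm]
      · simp [hγ]
    · rw [if_neg hi, if_neg, mul_zero]
      rintro rfl
      simp at hi

theorem polyFn_shiftPoly_cons {ev : E → ℂ} (i : Fin d) (L : List (Fin d)) (f : E) (ξ : Rd d) :
    polyFn (shiftPoly T κ ev (i :: L) f) ξ =
      polyFn (shiftPoly T κ ev L (T i f)) ξ + κ * (ξ i * polyFn (shiftPoly T κ ev L f) ξ) := by
  simp [polyFn, shiftPoly]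

/-- Linear combinations of shifted monomials with nonvanishing coefficients do not vanish. -/
theorem sum_shiftPoly_ne_zero {ev : E → ℂ} (hκ : κ ≠ 0) {S : Finset (Fin d →₀ ℕ)}
    (hS : S.Nonempty) {a : (Fin d →₀ ℕ) → ℂ} (ha : ∀ α ∈ S, a α ≠ 0) {f : E} (hf : ev f ≠ 0) :
    ∑ α ∈ S, MvPolynomial.C (a α) * shiftPoly T κ ev (indexList α) f ≠ 0 := by
  -- At an index of maximal degree no other summand contributes to the coefficient, so nothing can
  -- cancel.
  obtain ⟨α, hα, hmax⟩ := S.exists_max_image Finsupp.degree hS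
  intro h
  have hcoeff := congrArg (MvPolynomial.coeff α) h
  rw [MvPolynomial.coeff_sum, MvPolynomial.coeff_zero, Finset.sum_eq_single α] at hcoeff
  · rw [MvPolynomial.coeff_C_mul, coeff_shiftPoly _ _ _ (length_indexList α).le,
      if_pos (listIndex_indexList α).symm] at hcoeff
    exact mul_ne_zero (ha α hα) (mul_ne_zero (pow_ne_zero _ hκ) hf) hcoeff
  · intro β hβ hne
    rw [MvPolynomial.coeff_C_mul, coeff_shiftPoly _ _ _ (by
      rw [length_indexList]; exact hmax β hβ), if_neg, mul_zero]
    rw [listIndex_indexList]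
    exact hne.symm
  · exact fun h => absurd hα h

/-- Each factor costs at most one power of `1 + ‖ξ‖`. The induction passes from `f` to `T i f`,
hence the class `P` stable under `T`: it is trivial for rapid decay, and consists of Gelfand–Shilov
type bounds for superexponential decay. -/
theorem exists_shiftPoly_le {ev : Rd d → E → ℂ} {w : Rd d → ℝ} (hw : ∀ x, 0 ≤ w x)
    {P : E → Prop} (hT : ∀ i f, P f → P (T i f))
    (hP : ∀ f, P f → ∃ C : ℝ, ∀ x, w x * ‖ev x f‖ ≤ C) (L : List (Fin d)) (f : E) (hf : P f) :
    ∃ C : ℝ, ∀ x ξ, w x * ‖polyFn (shiftPoly T κ (ev x) L f) ξ‖ ≤ C * (1 + ‖ξ‖) ^ L.length := by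
  induction L generalizing f with
  | nil =>
    obtain ⟨C, hC⟩ := hP f hf
    exact ⟨C, fun x ξ => by simpa [shiftPoly, polyFn] using hC x⟩
  | cons i L ih =>
    obtain ⟨C₁, h₁⟩ := ih _ (hT i f hf)
    obtain ⟨C₂, h₂⟩ := ih f hf
    refine ⟨C₁ + ‖κ‖ * C₂, fun x ξ => ?_⟩
    have hC₁ : 0 ≤ C₁ := by
      have := h₁ 0 0
      simp only [norm_zero, add_zero, one_pow, mul_one] at this
      exact (mul_nonneg (hw 0) (norm_nonneg _)).trans this
    have hξ : |ξ i| ≤ 1 + ‖ξ‖ := by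
      have := PiLp.norm_apply_le ξ i
      rw [Real.norm_eq_abs] at this
      linarith
    have h1 : (1 : ℝ) ≤ 1 + ‖ξ‖ := by linarith [norm_nonneg ξ]
    rw [polyFn_shiftPoly_cons]
    calc w x * ‖polyFn (shiftPoly T κ (ev x) L (T i f)) ξ +
          κ * (ξ i * polyFn (shiftPoly T κ (ev x) L f) ξ)‖
        ≤ w x * (‖polyFn (shiftPoly T κ (ev x) L (T i f)) ξ‖ +
          ‖κ * (ξ i * polyFn (shiftPoly T κ (ev x) L f) ξ)‖) :=
          mul_le_mul_of_nonneg_left (norm_add_le _ _) (hw x)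
      _ = w x * ‖polyFn (shiftPoly T κ (ev x) L (T i f)) ξ‖ +
          ‖κ‖ * (|ξ i| * (w x * ‖polyFn (shiftPoly T κ (ev x) L f) ξ‖)) := by
          rw [norm_mul, norm_mul, Complex.norm_real, Real.norm_eq_abs]
          ring
      _ ≤ C₁ * (1 + ‖ξ‖) ^ L.length * (1 + ‖ξ‖) +
          ‖κ‖ * ((1 + ‖ξ‖) * (C₂ * (1 + ‖ξ‖) ^ L.length)) := by
          refine add_le_add ((h₁ x ξ).trans (le_mul_of_one_le_right (by positivity) h1)) ?_
          exact mul_le_mul_of_nonneg_left (mul_le_mul hξ (h₂ x ξ)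
            (mul_nonneg (hw x) (norm_nonneg _)) (by positivity)) (norm_nonneg _)
      _ = _ := by rw [List.length_cons, pow_succ]; ring

theorem exists_sum_shiftPoly_le {ev : Rd d → E → ℂ} {w : Rd d → ℝ} (hw : ∀ x, 0 ≤ w x)
    {P : E → Prop} (hT : ∀ i f, P f → P (T i f))
    (hP : ∀ f, P f → ∃ C : ℝ, ∀ x, w x * ‖ev x f‖ ≤ C) (S : Finset (Fin d →₀ ℕ))
    (a : (Fin d →₀ ℕ) → ℂ) (f : E) (hf : P f) :
    ∃ C : ℝ, ∀ x ξ,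
      w x * ‖polyFn (∑ α ∈ S, MvPolynomial.C (a α) * shiftPoly T κ (ev x) (indexList α) f) ξ‖ ≤
        C * (1 + ‖ξ‖) ^ S.sup Finsupp.degree := by
  choose C hC using fun α => exists_shiftPoly_le (κ := κ) hw hT hP (indexList α) f hf
  have hCnn : ∀ α, 0 ≤ C α := fun α => by
    have := hC α 0 0
    simp only [norm_zero, add_zero, one_pow, mul_one] at this
    exact (mul_nonneg (hw 0) (norm_nonneg _)).trans this
  refine ⟨∑ α ∈ S, ‖a α‖ * C α, fun x ξ => ?_⟩
  have h1 : (1 : ℝ) ≤ 1 + ‖ξ‖ := by linarith [norm_nonneg ξ]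
  have hsum : polyFn (∑ α ∈ S, MvPolynomial.C (a α) * shiftPoly T κ (ev x) (indexList α) f) ξ =
      ∑ α ∈ S, a α * polyFn (shiftPoly T κ (ev x) (indexList α) f) ξ := by
    simp [polyFn]
  rw [hsum, Finset.sum_mul]
  calc w x * ‖∑ α ∈ S, a α * polyFn (shiftPoly T κ (ev x) (indexList α) f) ξ‖
      ≤ w x * ∑ α ∈ S, ‖a α * polyFn (shiftPoly T κ (ev x) (indexList α) f) ξ‖ :=
        mul_le_mul_of_nonneg_left (norm_sum_le _ _) (hw x)
    _ = ∑ α ∈ S, ‖a α‖ * (w x * ‖polyFn (shiftPoly T κ (ev x) (indexList α) f) ξ‖) := by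
        rw [Finset.mul_sum]
        refine Finset.sum_congr rfl fun α _ => ?_
        rw [norm_mul]
        ring
    _ ≤ _ := by
        refine Finset.sum_le_sum fun α hα => ?_
        rw [mul_assoc]
        refine mul_le_mul_of_nonneg_left ((hC α x ξ).trans ?_) (norm_nonneg _)
        refine mul_le_mul_of_nonneg_left (pow_le_pow_right₀ h1 ?_) (hCnn α)
        rw [length_indexList]
        exact Finset.le_sup hα

/-- The conic singular set of a function of the form `∑ a α ev (∏ (T i + κ ξ i) ^ α i f)`. -/
theorem conicSingularSet_eq_of_shiftPoly {V : Rd d → Rd d → ℂ} {ev : Rd d → E → ℂ}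
    {S : Finset (Fin d →₀ ℕ)} (hS : S.Nonempty) {a : (Fin d →₀ ℕ) → ℂ} (ha : ∀ α ∈ S, a α ≠ 0)
    (hκ : κ ≠ 0) {f : E}
    (hV : ∀ x ξ, ‖V x ξ‖ =
      ‖polyFn (∑ α ∈ S, MvPolynomial.C (a α) * shiftPoly T κ (ev x) (indexList α) f) ξ‖)
    (hne : ∃ x, ev x f ≠ 0)
    (hP : ∀ N : ℕ, ∀ f, ∃ C : ℝ, ∀ x, (1 + ‖x‖) ^ N * ‖ev x f‖ ≤ C) :
    conicSingularSet V = {z | z.1 = 0 ∧ z.2 ≠ 0} := by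
  obtain ⟨x, hx⟩ := hne
  exact conicSingularSet_eq hV ⟨x, sum_shiftPoly_ne_zero hκ hS ha hx⟩ _ fun N =>
    exists_sum_shiftPoly_le (fun x => by positivity) (P := fun _ => True)
      (fun _ _ _ => trivial) (fun f _ => hP N f) S a f trivial

/-- The anisotropic singular set of a function of the form `∑ a α ev (∏ (T i + κ ξ i) ^ α i f)`. -/
theorem anisotropicSingularSet_eq_of_shiftPoly {t s : ℝ} (ht : 0 < t) (hs : 0 < s)
    {V : Rd d → Rd d → ℂ} {ev : Rd d → E → ℂ}
    {S : Finset (Fin d →₀ ℕ)} (hS : S.Nonempty) {a : (Fin d →₀ ℕ) → ℂ} (ha : ∀ α ∈ S, a α ≠ 0)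
    (hκ : κ ≠ 0) {f : E}
    (hV : ∀ x ξ, ‖V x ξ‖ =
      ‖polyFn (∑ α ∈ S, MvPolynomial.C (a α) * shiftPoly T κ (ev x) (indexList α) f) ξ‖)
    (hne : ∃ x, ev x f ≠ 0) {P : E → Prop} (hf : P f) (hT : ∀ i f, P f → P (T i f))
    (hP : ∀ f, P f → ∀ j : Fin d, ∀ r : ℝ, 0 < r → ∃ C : ℝ, ∀ x,
      Real.exp (r * |x j| ^ (1 / t)) * ‖ev x f‖ ≤ C) :
    anisotropicSingularSet t s V = {z | z.1 = 0 ∧ z.2 ≠ 0} := by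
  obtain ⟨x, hx⟩ := hne
  exact anisotropicSingularSet_eq ht hs hV ⟨x, sum_shiftPoly_ne_zero hκ hS ha hx⟩ _ fun j r hr =>
    exists_sum_shiftPoly_le (fun x => by positivity) hT (fun f hf => hP f hf j r hr) S a f hf

end

/-! ### Derivatives, coordinates, modulations and translations of Schwartz functions -/

/-- The partial derivative `∂_i` of a Schwartz function. -/
noncomputable def partialD {d : ℕ} (i : Fin d) (f : 𝓢(Rd d, ℂ)) : 𝓢(Rd d, ℂ) :=
  ∂_{(EuclideanSpace.single i (1 : ℝ) : Rd d)} f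

theorem coord_hasTemperateGrowth {d : ℕ} (i : Fin d) :
    (fun y : Rd d => ((y i : ℝ) : ℂ)).HasTemperateGrowth :=
  ContinuousLinearMap.hasTemperateGrowth
    (Complex.ofRealCLM ∘L (EuclideanSpace.proj (𝕜 := ℝ) i : Rd d →L[ℝ] ℝ))

/-- Multiplication of a Schwartz function by the coordinate `y_i`. -/
noncomputable def coordMul {d : ℕ} (i : Fin d) (f : 𝓢(Rd d, ℂ)) : 𝓢(Rd d, ℂ) :=
  SchwartzMap.smulLeftCLM ℂ (fun y : Rd d => ((y i : ℝ) : ℂ)) f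

@[simp]
theorem coordMul_apply {d : ℕ} (i : Fin d) (f : 𝓢(Rd d, ℂ)) (y : Rd d) :
    coordMul i f y = y i * f y := by
  simp [coordMul, SchwartzMap.smulLeftCLM_apply_apply (coord_hasTemperateGrowth i)]

theorem partialD_apply {d : ℕ} (i : Fin d) (f : 𝓢(Rd d, ℂ)) (y : Rd d) :
    partialD i f y = fderiv ℝ f y (EuclideanSpace.single i 1) := by
  rw [partialD, SchwartzMap.lineDerivOp_apply_eq_fderiv]

theorem partialD_smul {d : ℕ} (i : Fin d) (c : ℂ) (f : 𝓢(Rd d, ℂ)) :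
    partialD i (c • f) = c • partialD i f :=
  LineDeriv.lineDerivOp_smul _ _ _

theorem partialD_comm {d : ℕ} (i j : Fin d) (f : 𝓢(Rd d, ℂ)) :
    partialD i (partialD j f) = partialD j (partialD i f) := by
  ext y
  have hd : DifferentiableAt ℝ (fderiv ℝ f) y :=
    ((f.smooth 2).fderiv_right (m := 1) (by norm_num)).differentiable (by norm_num) y
  have key : ∀ i j : Fin d, partialD i (partialD j f) y =
      fderiv ℝ (fderiv ℝ f) y (EuclideanSpace.single i 1) (EuclideanSpace.single j 1) := by
    intro i j
    rw [partialD_apply]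
    have : (partialD j f : Rd d → ℂ) =
        fun y => fderiv ℝ f y (EuclideanSpace.single j 1) := funext fun y => partialD_apply j f y
    rw [this, fderiv_clm_apply hd (differentiableAt_const _)]
    simp
  rw [key, key]
  exact ((f.smooth 2).contDiffAt.isSymmSndFDerivAt (by simp)) _ _

theorem partialD_conjugate {d : ℕ} (i : Fin d) (f : 𝓢(Rd d, ℂ)) :
    partialD i (conjugate f) = conjugate (partialD i f) := by
  ext y
  have h : HasFDerivAt (conjugate f : Rd d → ℂ)
      ((Complex.conjCLE : ℂ →L[ℝ] ℂ) ∘L fderiv ℝ f y) y := by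
    have := (Complex.conjCLE : ℂ →L[ℝ] ℂ).hasFDerivAt.comp y
      (f.differentiableAt (x := y)).hasFDerivAt
    exact this.congr_of_eventuallyEq (Eventually.of_forall fun z => by simp)
  rw [partialD_apply, h.fderiv, conjugate_apply, partialD_apply]
  simp

theorem partialD_translation {d : ℕ} (i : Fin d) (x : Rd d) (f : 𝓢(Rd d, ℂ)) :
    partialD i (translation x f) = translation x (partialD i f) := by
  ext y
  rw [partialD_apply, translation_apply, partialD_apply]
  have : (translation x f : Rd d → ℂ) = fun y => f (y - x) := rfl
  rw [this, fderiv_comp_sub]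

/-- This commutation rule is the recursion of `shiftPoly` with `T = partialD`; its counterpart for
`coordMul` is `coordMul_modulation_translation`. -/
theorem partialD_modulation {d : ℕ} (i : Fin d) (ξ : Rd d) (f : 𝓢(Rd d, ℂ)) :
    partialD i (modulation ξ f) =
      modulation ξ (partialD i f) + (Complex.I * ξ i) • modulation ξ f := by
  ext y
  have h1 : HasFDerivAt (fun y : Rd d => Complex.I * ((inner ℝ y ξ : ℝ) : ℂ))
      (Complex.I • (Complex.ofRealCLM ∘L (innerSL ℝ).flip ξ)) y :=
    ((Complex.ofRealCLM ∘L (innerSL ℝ).flip ξ).hasFDerivAt (x := y)).const_mul Complex.I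
  have h2 := h1.cexp.mul (f.differentiableAt (x := y)).hasFDerivAt
  have h3 : (modulation ξ f : Rd d → ℂ) =
      fun y => Complex.exp (Complex.I * ((inner ℝ y ξ : ℝ) : ℂ)) * f y :=
    funext fun y => modulation_apply ξ f y
  have h4 := h2.fderiv
  rw [partialD_apply, h3]
  erw [h4]
  have h5 : innerSL ℝ ξ (EuclideanSpace.single i (1 : ℝ)) = ξ i := by
    rw [innerSL_apply_apply ℝ, EuclideanSpace.inner_single_right]
    simp
  simp [partialD_apply, planeWave, h5]
  ring

theorem partialD_coordMul {d : ℕ} (i j : Fin d) (f : 𝓢(Rd d, ℂ)) :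
    partialD j (coordMul i f) = coordMul i (partialD j f) + (if i = j then (1 : ℂ) else 0) • f := by
  ext y
  have h1 : HasFDerivAt (fun y : Rd d => ((y i : ℝ) : ℂ))
      (Complex.ofRealCLM ∘L (EuclideanSpace.proj (𝕜 := ℝ) i : Rd d →L[ℝ] ℝ)) y :=
    (Complex.ofRealCLM ∘L (EuclideanSpace.proj (𝕜 := ℝ) i : Rd d →L[ℝ] ℝ)).hasFDerivAt
  have h2 := h1.mul (f.differentiableAt (x := y)).hasFDerivAt
  have h3 : (coordMul i f : Rd d → ℂ) = fun y => ((y i : ℝ) : ℂ) * f y :=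
    funext fun y => coordMul_apply i f y
  rw [partialD_apply, h3]
  erw [h2.fderiv]
  by_cases h : i = j
  · subst h
    simp [partialD_apply]
  · simp [partialD_apply, h]

theorem conjugate_modulation_translation {d : ℕ} (x ξ : Rd d) (f : 𝓢(Rd d, ℂ)) :
    conjugate (modulation ξ (translation x f)) =
      modulation (-ξ) (translation x (conjugate f)) := by
  ext y
  simp [planeWave, ← Complex.exp_conj]

theorem conjugate_ne_zero {d : ℕ} {f : 𝓢(Rd d, ℂ)} (hf : f ≠ 0) : conjugate f ≠ 0 := by
  intro h
  refine hf (SchwartzMap.ext fun y => ?_)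
  have := congrArg (fun g : 𝓢(Rd d, ℂ) => g y) h
  simpa using this

theorem coordMul_modulation_translation {d : ℕ} (i : Fin d) (x ξ : Rd d) (f : 𝓢(Rd d, ℂ)) :
    coordMul i (modulation ξ (translation x f)) =
      modulation ξ (translation x (coordMul i f)) +
        (x i : ℂ) • modulation ξ (translation x f) := by
  ext y
  simp
  ring

/-! ### The Fourier transform -/

/-- The Fourier transform with the normalization `ξ ↦ ∫ exp (-i ⟨y, ξ⟩) f(y) dy`. -/
noncomputable def angularFourier {d : ℕ} (ξ : Rd d) (f : 𝓢(Rd d, ℂ)) : ℂ :=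
  𝓕 f ((2 * Real.pi)⁻¹ • ξ)

theorem angularFourier_eq_integral {d : ℕ} (ξ : Rd d) (f : 𝓢(Rd d, ℂ)) :
    angularFourier ξ f = ∫ y, planeWave (-ξ) y * f y := by
  rw [angularFourier, SchwartzMap.fourier_coe, Real.fourier_eq']
  refine integral_congr_ae (Eventually.of_forall fun y => ?_)
  simp only [planeWave, smul_eq_mul, inner_smul_right, inner_neg_right]
  congr 2
  push_cast
  have : (Real.pi : ℂ) ≠ 0 := by exact_mod_cast Real.pi_ne_zero
  field_simp

theorem angularFourier_partialD {d : ℕ} (i : Fin d) (ξ : Rd d) (f : 𝓢(Rd d, ℂ)) :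
    angularFourier ξ (partialD i f) = Complex.I * ξ i * angularFourier ξ f := by
  have hg : (inner ℝ · (EuclideanSpace.single i (1 : ℝ) : Rd d)).HasTemperateGrowth :=
    ((innerSL ℝ).flip (EuclideanSpace.single i (1 : ℝ) : Rd d)).hasTemperateGrowth
  rw [angularFourier, partialD, SchwartzMap.fourier_lineDerivOp_eq, smul_apply,
    SchwartzMap.smulLeftCLM_apply_apply hg, angularFourier, EuclideanSpace.inner_single_right]
  have : (Real.pi : ℂ) ≠ 0 := by exact_mod_cast Real.pi_ne_zero
  simp
  field_simp

theorem exists_angularFourier_ne_zero {d : ℕ} {f : 𝓢(Rd d, ℂ)} (hf : f ≠ 0) :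
    ∃ ξ, angularFourier ξ f ≠ 0 := by
  by_contra! h
  have h0 : 𝓕 f = 0 := by
    ext η
    have := h ((2 * Real.pi) • η)
    rwa [angularFourier, inv_smul_smul₀ (by positivity)] at this
  have h1 : 𝓕⁻ (𝓕 f) = f := FourierTransform.fourierInv_fourier_eq f
  rw [h0] at h1
  refine hf (h1.symm.trans ?_)
  exact FourierTransform.fourierInv_zero

theorem exists_one_add_norm_pow_mul_le {d : ℕ} (f : 𝓢(Rd d, ℂ)) (N : ℕ) :
    ∃ C : ℝ, ∀ x, (1 + ‖x‖) ^ N * ‖f x‖ ≤ C :=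
  ⟨_, fun x => by
    simpa using SchwartzMap.one_add_le_sup_seminorm_apply (𝕜 := ℝ) (m := (N, 0)) (k := N) (n := 0)
      le_rfl le_rfl f x⟩

theorem exists_one_add_norm_pow_mul_angularFourier_le {d : ℕ} (N : ℕ) (f : 𝓢(Rd d, ℂ)) :
    ∃ C : ℝ, ∀ ξ, (1 + ‖ξ‖) ^ N * ‖angularFourier ξ f‖ ≤ C := by
  obtain ⟨C, hC⟩ := exists_one_add_norm_pow_mul_le (𝓕 f) N
  refine ⟨(2 * Real.pi) ^ N * C, fun ξ => ?_⟩
  have hpi : 1 ≤ 2 * Real.pi := by linarith [Real.two_le_pi]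
  have h1 : 1 + ‖ξ‖ ≤ 2 * Real.pi * (1 + ‖(2 * Real.pi)⁻¹ • ξ‖) := by
    rw [norm_smul, Real.norm_eq_abs, abs_of_pos (by positivity), mul_add, mul_one,
      mul_inv_cancel_left₀ (by positivity)]
    linarith
  calc (1 + ‖ξ‖) ^ N * ‖angularFourier ξ f‖
      ≤ (2 * Real.pi * (1 + ‖(2 * Real.pi)⁻¹ • ξ‖)) ^ N * ‖angularFourier ξ f‖ := by gcongr
    _ = (2 * Real.pi) ^ N * ((1 + ‖(2 * Real.pi)⁻¹ • ξ‖) ^ N * ‖angularFourier ξ f‖) := by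
      rw [mul_pow, mul_assoc]
    _ ≤ _ := by
      gcongr
      exact hC _

/-! ### From Gelfand–Shilov estimates to superexponential decay -/

/-- Bounds on all moments of Gevrey type give superexponential decay. -/
theorem exists_exp_mul_le_of_forall_pow_mul_le {t r : ℝ} (ht : 0 < t) (hr : 0 < r) :
    ∃ h : ℝ, 0 < h ∧ ∀ C y b : ℝ, 0 ≤ y → 0 ≤ b →
      (∀ k : ℕ, y ^ k * b ≤ C * (h ^ k * (k.factorial : ℝ) ^ t)) →
      Real.exp (r * y ^ (1 / t)) * b ≤ 2 ^ t * C := by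
  -- Taking `1/t`-th powers turns `k!^t` into `k!`, so that an exponential series in `ρ y^(1/t)` can
  -- be summed; the final `t`-th power restores the rate `r`.
  set ρ : ℝ := r / t with hρ
  have hρpos : 0 < ρ := by positivity
  -- This `h` bounds the terms by a geometric series of ratio `1/2`, whose sum `2` becomes the
  -- factor `2 ^ t`.
  refine ⟨((2 * ρ)⁻¹) ^ t, by positivity, fun C y b hy hb hk => ?_⟩
  have hC : 0 ≤ C := by
    have := hk 0
    simp only [pow_zero, one_mul, Nat.factorial_zero, Nat.cast_one, Real.one_rpow, mul_one] at this
    exact hb.trans this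
  set z : ℝ := y ^ (1 / t) with hz
  have hznn : 0 ≤ z := by positivity
  have hzt : z ^ t = y := by
    rw [hz, ← Real.rpow_mul hy, one_div_mul_cancel ht.ne', Real.rpow_one]
  set B : ℝ := b ^ (1 / t) with hB
  have hBt : B ^ t = b := by
    rw [hB, ← Real.rpow_mul hb, one_div_mul_cancel ht.ne', Real.rpow_one]
  set D : ℝ := C ^ (1 / t) with hD
  have hDt : D ^ t = C := by
    rw [hD, ← Real.rpow_mul hC, one_div_mul_cancel ht.ne', Real.rpow_one]
  have hBnn : 0 ≤ B := by positivity
  have hDnn : 0 ≤ D := by positivity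
  have hterm : ∀ k : ℕ, B * ((ρ * z) ^ k / k.factorial) ≤ D * (1 / 2) ^ k := by
    intro k
    have hfac : (0 : ℝ) < k.factorial := by exact_mod_cast k.factorial_pos
    have h1 : (z ^ k * B) ^ t ≤ (D * (((2 * ρ)⁻¹) ^ k * k.factorial)) ^ t := by
      rw [Real.mul_rpow (by positivity) hBnn, hBt, Real.mul_rpow hDnn (by positivity), hDt,
        Real.mul_rpow (by positivity) hfac.le, ← Real.rpow_natCast_mul hznn,
        ← Real.rpow_natCast_mul (by positivity), mul_comm (k : ℝ) t, Real.rpow_mul_natCast hznn,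
        Real.rpow_mul_natCast (by positivity), hzt]
      exact hk k
    have h2 := (Real.rpow_le_rpow_iff (by positivity) (by positivity) ht).1 h1
    rw [mul_div_assoc', div_le_iff₀ hfac]
    calc B * (ρ * z) ^ k = ρ ^ k * (z ^ k * B) := by rw [mul_pow]; ring
      _ ≤ ρ ^ k * (D * (((2 * ρ)⁻¹) ^ k * k.factorial)) := by gcongr
      _ = (ρ * (2 * ρ)⁻¹) ^ k * (D * k.factorial) := by rw [mul_pow]; ring
      _ = D * (1 / 2) ^ k * k.factorial := by
        rw [show ρ * (2 * ρ)⁻¹ = 1 / 2 by field_simp]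
        ring
  have hexp : HasSum (fun k : ℕ => (ρ * z) ^ k / (k.factorial : ℝ)) (Real.exp (ρ * z)) := by
    rw [Real.exp_eq_exp_ℝ]
    exact NormedSpace.expSeries_div_hasSum_exp (ρ * z)
  have hsum : B * Real.exp (ρ * z) ≤ D * 2 :=
    hasSum_le hterm (hexp.mul_left B) (hasSum_geometric_two.mul_left D)
  have hpow := Real.rpow_le_rpow (by positivity) hsum ht.le
  rw [Real.mul_rpow hBnn (Real.exp_pos _).le, Real.mul_rpow hDnn (by norm_num), hBt, hDt,
    ← Real.exp_mul] at hpow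
  have hρz : ρ * z * t = r * z := by rw [hρ]; field_simp
  rw [hρz] at hpow
  linarith

/-- The iterated partial derivative `∂^β`. -/
noncomputable def iterD {d : ℕ} (L : List (Fin d)) (β : Fin d →₀ ℕ) (f : 𝓢(Rd d, ℂ)) :
    𝓢(Rd d, ℂ) :=
  L.foldr (fun i g => (partialD i)^[β i] g) f

theorem iterD_cons {d : ℕ} (i : Fin d) (L : List (Fin d)) (β : Fin d →₀ ℕ) (f : 𝓢(Rd d, ℂ)) :
    iterD (i :: L) β f = (partialD i)^[β i] (iterD L β f) := rfl

theorem multiD_eq_smul_iterD {d : ℕ} (β : Fin d →₀ ℕ) (f : 𝓢(Rd d, ℂ)) :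
    multiD β f = (-Complex.I) ^ multiLength β • iterD (List.finRange d) β f := rfl

theorem norm_multiD_apply {d : ℕ} (β : Fin d →₀ ℕ) (f : 𝓢(Rd d, ℂ)) (x : Rd d) :
    ‖multiD β f x‖ = ‖iterD (List.finRange d) β f x‖ := by
  rw [multiD_eq_smul_iterD]
  simp

theorem partialD_iterate_comm {d : ℕ} (i j : Fin d) (n : ℕ) (f : 𝓢(Rd d, ℂ)) :
    (partialD j)^[n] (partialD i f) = partialD i ((partialD j)^[n] f) :=
  Function.Commute.iterate_left (f := partialD j) (g := partialD i) (partialD_comm j i) n f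

theorem iterD_partialD {d : ℕ} (i : Fin d) (L : List (Fin d)) (β : Fin d →₀ ℕ)
    (f : 𝓢(Rd d, ℂ)) : iterD L β (partialD i f) = partialD i (iterD L β f) := by
  induction L with
  | nil => rfl
  | cons j L ih => rw [iterD_cons, ih, partialD_iterate_comm, iterD_cons]

/-- Derivatives commute, so the new one moves to the front; without repetitions in `L` it is counted
only once. -/
theorem iterD_single_add {d : ℕ} (i : Fin d) {L : List (Fin d)} (hL : L.Nodup)
    (β : Fin d →₀ ℕ) (f : 𝓢(Rd d, ℂ)) :
    iterD L (Finsupp.single i 1 + β) f =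
      if i ∈ L then partialD i (iterD L β f) else iterD L β f := by
  induction L with
  | nil => simp [iterD]
  | cons j L ih =>
    rw [List.nodup_cons] at hL
    rw [iterD_cons, ih hL.2, iterD_cons]
    by_cases hij : i = j
    · subst hij
      rw [if_neg hL.1, if_pos List.mem_cons_self, Finsupp.add_apply, Finsupp.single_eq_same,
        add_comm, Function.iterate_succ_apply']
    · have hβ : (Finsupp.single i 1 + β : Fin d →₀ ℕ) j = β j := by
        simp [hij]
      rw [hβ]
      by_cases hi : i ∈ L
      · rw [if_pos hi, if_pos (List.mem_cons_of_mem _ hi), partialD_iterate_comm]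
      · rw [if_neg hi, if_neg (by simp [hij, hi])]

theorem iterD_finRange_partialD {d : ℕ} (i : Fin d) (β : Fin d →₀ ℕ) (f : 𝓢(Rd d, ℂ)) :
    iterD (List.finRange d) β (partialD i f) =
      iterD (List.finRange d) (Finsupp.single i 1 + β) f := by
  rw [iterD_partialD, iterD_single_add i (List.nodup_finRange d), if_pos (List.mem_finRange i)]

theorem iterD_finRange_single {d : ℕ} (i : Fin d) (k : ℕ) (f : 𝓢(Rd d, ℂ)) :
    iterD (List.finRange d) (Finsupp.single i k) f = (partialD i)^[k] f := by
  induction k generalizing f with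
  | zero =>
    have h : ∀ L : List (Fin d), iterD L 0 f = f := by
      intro L
      induction L with
      | nil => rfl
      | cons j L ih => rw [iterD_cons, ih]; rfl
    simpa using h _
  | succ k ih =>
    rw [Function.iterate_succ_apply, ← ih, iterD_finRange_partialD, ← Finsupp.single_add,
      add_comm]

theorem iterate_partialD_conjugate {d : ℕ} (i : Fin d) (n : ℕ) (f : 𝓢(Rd d, ℂ)) :
    (partialD i)^[n] (conjugate f) = conjugate ((partialD i)^[n] f) :=
  Function.Commute.iterate_left (f := partialD i) (g := conjugate) (partialD_conjugate i) n f

theorem iterD_conjugate {d : ℕ} (L : List (Fin d)) (β : Fin d →₀ ℕ) (f : 𝓢(Rd d, ℂ)) :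
    iterD L β (conjugate f) = conjugate (iterD L β f) := by
  induction L with
  | nil => rfl
  | cons j L ih => rw [iterD_cons, ih, iterate_partialD_conjugate, iterD_cons]

/-- Needed because the action is conjugate linear in the window, so the conjugate window enters all
coefficients. -/
theorem IsGelfandShilov.conjugate {d : ℕ} {t s : ℝ} {f : 𝓢(Rd d, ℂ)}
    (hf : IsGelfandShilov t s f) : IsGelfandShilov t s (conjugate f) := by
  intro h hh
  obtain ⟨C, hC⟩ := hf h hh
  refine ⟨C, fun α β x => ?_⟩
  have hnorm : ‖multiD β (AnisotropicWF.conjugate f) x‖ = ‖multiD β f x‖ := by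
    rw [norm_multiD_apply, iterD_conjugate, conjugate_apply, RCLike.norm_conj, norm_multiD_apply]
  rw [norm_mul, hnorm, ← norm_mul]
  exact hC α β x

theorem multiLength_add {d : ℕ} (α β : Fin d →₀ ℕ) :
    multiLength (α + β) = multiLength α + multiLength β := by
  simp [multiLength, Finset.sum_add_distrib]

theorem multiLength_single {d : ℕ} (i : Fin d) (k : ℕ) :
    multiLength (Finsupp.single i k) = k := by
  simp [multiLength, Finsupp.single_apply]

theorem multiFactorial_single {d : ℕ} (i : Fin d) (k : ℕ) :
    multiFactorial (Finsupp.single i k) = k.factorial := by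
  rw [multiFactorial, Finset.prod_eq_single i]
  · simp
  · intro j _ hj
    simp [hj.symm]
  · simp

theorem monomialFn_single {d : ℕ} (i : Fin d) (k : ℕ) (x : Rd d) :
    monomialFn (Finsupp.single i k) x = x i ^ k := by
  rw [monomialFn, Finset.prod_eq_single i]
  · simp
  · intro j _ hj
    simp [hj.symm]
  · simp

theorem multiFactorial_pos {d : ℕ} (α : Fin d →₀ ℕ) : 0 < multiFactorial α :=
  Finset.prod_pos fun _ _ => Nat.factorial_pos _

theorem IsGelfandShilov.exists_le {d : ℕ} {t s : ℝ} {f : 𝓢(Rd d, ℂ)}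
    (hf : IsGelfandShilov t s f) {h : ℝ} (hh : 0 < h) :
    ∃ C : ℝ, ∀ (α β : Fin d →₀ ℕ) (x : Rd d),
      |monomialFn α x| * ‖iterD (List.finRange d) β f x‖ ≤
        C * (h ^ (multiLength α + multiLength β) * (multiFactorial α : ℝ) ^ t *
          (multiFactorial β : ℝ) ^ s) := by
  obtain ⟨C, hC⟩ := hf h hh
  refine ⟨C, fun α β x => ?_⟩
  have h1 : (0 : ℝ) < multiFactorial α := by exact_mod_cast multiFactorial_pos α
  have h2 : (0 : ℝ) < multiFactorial β := by exact_mod_cast multiFactorial_pos β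
  have := hC α β x
  rwa [div_le_iff₀ (by positivity), norm_mul, norm_multiD_apply, multiLength_add,
    Complex.norm_real, Real.norm_eq_abs] at this

/-- Uniform Gevrey type bounds on the moments of each derivative. -/
def HasMomentBounds {d : ℕ} (t : ℝ) (f : 𝓢(Rd d, ℂ)) : Prop :=
  ∀ (β : Fin d →₀ ℕ) (h : ℝ), 0 < h → ∃ C : ℝ, ∀ (j : Fin d) (k : ℕ) (x : Rd d),
    |x j| ^ k * ‖iterD (List.finRange d) β f x‖ ≤ C * (h ^ k * (k.factorial : ℝ) ^ t)

theorem IsGelfandShilov.hasMomentBounds {d : ℕ} {t s : ℝ} {f : 𝓢(Rd d, ℂ)}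
    (hf : IsGelfandShilov t s f) : HasMomentBounds t f := by
  intro β h hh
  obtain ⟨C, hC⟩ := hf.exists_le hh
  refine ⟨C * (h ^ multiLength β * (multiFactorial β : ℝ) ^ s), fun j k x => ?_⟩
  have := hC (Finsupp.single j k) β x
  rw [monomialFn_single, multiLength_single, multiFactorial_single, abs_pow, pow_add] at this
  linarith

/-- Every `β` is allowed its own constant, so one more derivative only shifts `β`. -/
theorem HasMomentBounds.partialD {d : ℕ} {t : ℝ} {f : 𝓢(Rd d, ℂ)} (hf : HasMomentBounds t f)
    (i : Fin d) : HasMomentBounds t (partialD i f) := by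
  intro β h hh
  simpa only [iterD_finRange_partialD] using hf (Finsupp.single i 1 + β) h hh

theorem HasMomentBounds.exists_exp_mul_le {d : ℕ} {t : ℝ} (ht : 0 < t) {f : 𝓢(Rd d, ℂ)}
    (hf : HasMomentBounds t f) (j : Fin d) {r : ℝ} (hr : 0 < r) :
    ∃ C : ℝ, ∀ x, Real.exp (r * |x j| ^ (1 / t)) * ‖f x‖ ≤ C := by
  obtain ⟨h, hh, hdecay⟩ := exists_exp_mul_le_of_forall_pow_mul_le ht hr
  obtain ⟨C, hC⟩ := hf 0 h hh
  have h0 : iterD (List.finRange d) 0 f = f := by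
    simpa using iterD_finRange_single j 0 f
  rw [h0] at hC
  exact ⟨2 ^ t * C, fun x => hdecay C _ _ (abs_nonneg _) (norm_nonneg _) fun k => hC j k x⟩

/-- Uniform Gevrey type bounds on the derivatives, with arbitrary polynomial weights. -/
def HasDerivativeBounds {d : ℕ} (s : ℝ) (f : 𝓢(Rd d, ℂ)) : Prop :=
  ∀ (p : MvPolynomial (Fin d) ℂ) (h : ℝ), 0 < h → ∃ C : ℝ, ∀ (j : Fin d) (k : ℕ) (y : Rd d),
    ‖polyFn p y‖ * ‖(partialD j)^[k] f y‖ ≤ C * (h ^ k * (k.factorial : ℝ) ^ s)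

theorem norm_polyFn_le {d : ℕ} (p : MvPolynomial (Fin d) ℂ) (y : Rd d) :
    ‖polyFn p y‖ ≤ ∑ α ∈ p.support, ‖p.coeff α‖ * |monomialFn α y| := by
  rw [polyFn, MvPolynomial.eval_eq']
  refine (norm_sum_le _ _).trans (Finset.sum_le_sum fun α _ => ?_)
  rw [norm_mul, monomialFn, Finset.abs_prod, norm_prod]
  simp

theorem IsGelfandShilov.hasDerivativeBounds {d : ℕ} {t s : ℝ} {f : 𝓢(Rd d, ℂ)}
    (hf : IsGelfandShilov t s f) : HasDerivativeBounds s f := by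
  intro p h hh
  obtain ⟨C, hC⟩ := hf.exists_le hh
  refine ⟨∑ α ∈ p.support,
    ‖p.coeff α‖ * (C * (h ^ multiLength α * (multiFactorial α : ℝ) ^ t)), fun j k y => ?_⟩
  refine (mul_le_mul_of_nonneg_right (norm_polyFn_le p y) (norm_nonneg _)).trans ?_
  rw [Finset.sum_mul, Finset.sum_mul]
  refine Finset.sum_le_sum fun α _ => ?_
  have := hC α (Finsupp.single j k) y
  rw [iterD_finRange_single, multiLength_single, multiFactorial_single, pow_add] at this
  rw [mul_assoc, mul_assoc]
  refine mul_le_mul_of_nonneg_left (this.trans (le_of_eq ?_)) (norm_nonneg _)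
  ring

/-- Leibniz rule; at `k = 0` the truncated `k - 1` is harmless because of the factor `k`. -/
theorem iterate_partialD_coordMul {d : ℕ} (i j : Fin d) (k : ℕ) (f : 𝓢(Rd d, ℂ)) :
    (partialD j)^[k] (coordMul i f) = coordMul i ((partialD j)^[k] f) +
      ((k : ℂ) * if i = j then 1 else 0) • (partialD j)^[k - 1] f := by
  induction k with
  | zero => simp
  | succ k ih =>
    have hadd : ∀ g₁ g₂ : 𝓢(Rd d, ℂ), partialD j (g₁ + g₂) = partialD j g₁ + partialD j g₂ :=
      fun g₁ g₂ => LineDeriv.lineDerivOp_add _ _ _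
    rw [Function.iterate_succ_apply', ih, hadd, partialD_coordMul, partialD_smul,
      ← Function.iterate_succ_apply' (partialD j), ← Function.iterate_succ_apply' (partialD j),
      Nat.add_sub_cancel]
    rcases Nat.eq_zero_or_pos k with rfl | hk
    · simp
    · rw [show (k - 1).succ = k by omega, add_assoc, ← add_smul]
      congr 2
      push_cast
      ring

/-- Absorbs the Leibniz factor `k ≤ 2^k` by halving `h`. -/
theorem natCast_mul_half_pow_le {h s : ℝ} (hh : 0 < h) (hs : 0 < s) (k : ℕ) :
    (k : ℝ) * ((h / 2) ^ (k - 1) * ((k - 1).factorial : ℝ) ^ s) ≤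
      2 / h * (h ^ k * (k.factorial : ℝ) ^ s) := by
  rcases k with _ | n
  · simp; positivity
  · rw [Nat.add_sub_cancel]
    have h1 : ((n + 1 : ℕ) : ℝ) ≤ 2 * 2 ^ n := by
      have : n + 1 < 2 ^ (n + 1) := Nat.lt_two_pow_self
      have h2 : ((n + 1 : ℕ) : ℝ) < 2 ^ (n + 1) := by exact_mod_cast this
      rw [pow_succ] at h2
      linarith
    have h2 : (n.factorial : ℝ) ^ s ≤ ((n + 1).factorial : ℝ) ^ s :=
      Real.rpow_le_rpow (by positivity)
        (by exact_mod_cast Nat.factorial_le (Nat.le_succ n)) hs.le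
    calc ((n + 1 : ℕ) : ℝ) * ((h / 2) ^ n * (n.factorial : ℝ) ^ s)
        ≤ 2 * 2 ^ n * ((h / 2) ^ n * ((n + 1).factorial : ℝ) ^ s) := by gcongr
      _ = 2 / h * (h ^ (n + 1) * ((n + 1).factorial : ℝ) ^ s) := by
        rw [div_pow, pow_succ]
        field_simp

/-- In the Leibniz rule, the coordinate factor joins the arbitrary polynomial weight, and the lower
derivative is estimated with `h / 2`. -/
theorem HasDerivativeBounds.coordMul {d : ℕ} {s : ℝ} (hs : 0 < s) {f : 𝓢(Rd d, ℂ)}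
    (hf : HasDerivativeBounds s f) (i : Fin d) : HasDerivativeBounds s (coordMul i f) := by
  intro p h hh
  obtain ⟨C₁, h₁⟩ := hf (p * MvPolynomial.X i) h hh
  obtain ⟨C₂, h₂⟩ := hf p (h / 2) (by positivity)
  refine ⟨C₁ + C₂ * (2 / h), fun j k y => ?_⟩
  have hC₂ : 0 ≤ C₂ := by
    have := h₂ j 0 y
    simp only [pow_zero, Nat.factorial_zero, Nat.cast_one, Real.one_rpow, mul_one] at this
    exact le_trans (by positivity) this
  have hpX : ‖polyFn (p * MvPolynomial.X i) y‖ = ‖polyFn p y‖ * ‖(y i : ℂ)‖ := by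
    simp [polyFn]
  rw [iterate_partialD_coordMul]
  have hδ : ‖(if i = j then 1 else 0 : ℂ)‖ ≤ 1 := by split_ifs <;> simp
  calc ‖polyFn p y‖ * ‖(AnisotropicWF.coordMul i ((partialD j)^[k] f) +
        ((k : ℂ) * if i = j then 1 else 0) • (partialD j)^[k - 1] f) y‖
      ≤ ‖polyFn p y‖ * (‖(y i : ℂ)‖ * ‖(partialD j)^[k] f y‖ +
          k * ‖(partialD j)^[k - 1] f y‖) := by
        refine mul_le_mul_of_nonneg_left ?_ (norm_nonneg _)
        rw [add_apply, smul_apply, coordMul_apply]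
        refine (norm_add_le _ _).trans (add_le_add (norm_mul _ _).le ?_)
        rw [norm_smul, norm_mul, Complex.norm_natCast]
        refine mul_le_mul_of_nonneg_right ?_ (norm_nonneg _)
        exact mul_le_of_le_one_right (Nat.cast_nonneg _) hδ
    _ = ‖polyFn (p * MvPolynomial.X i) y‖ * ‖(partialD j)^[k] f y‖ +
          k * (‖polyFn p y‖ * ‖(partialD j)^[k - 1] f y‖) := by rw [hpX]; ring
    _ ≤ C₁ * (h ^ k * (k.factorial : ℝ) ^ s) +
          k * (C₂ * ((h / 2) ^ (k - 1) * ((k - 1).factorial : ℝ) ^ s)) :=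
        add_le_add (h₁ j k y) (mul_le_mul_of_nonneg_left (h₂ j (k - 1) y) (Nat.cast_nonneg _))
    _ = C₁ * (h ^ k * (k.factorial : ℝ) ^ s) +
          C₂ * (k * ((h / 2) ^ (k - 1) * ((k - 1).factorial : ℝ) ^ s)) := by ring
    _ ≤ C₁ * (h ^ k * (k.factorial : ℝ) ^ s) +
          C₂ * (2 / h * (h ^ k * (k.factorial : ℝ) ^ s)) := by
        exact add_le_add_right
          (mul_le_mul_of_nonneg_left (natCast_mul_half_pow_le hh hs k) hC₂) _
    _ = _ := by ring

theorem angularFourier_iterate_partialD {d : ℕ} (i : Fin d) (k : ℕ) (ξ : Rd d)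
    (f : 𝓢(Rd d, ℂ)) :
    angularFourier ξ ((partialD i)^[k] f) = (Complex.I * ξ i) ^ k * angularFourier ξ f := by
  induction k with
  | zero => simp
  | succ k ih => rw [Function.iterate_succ_apply', angularFourier_partialD, ih, pow_succ]; ring

theorem norm_angularFourier_le {d : ℕ} (ξ : Rd d) (f : 𝓢(Rd d, ℂ)) :
    ‖angularFourier ξ f‖ ≤ ∫ y, ‖f y‖ := by
  rw [angularFourier_eq_integral]
  refine (norm_integral_le_integral_norm _).trans (le_of_eq ?_)
  refine integral_congr_ae (Eventually.of_forall fun y => ?_)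
  simp [planeWave, Complex.norm_exp]

theorem HasDerivativeBounds.exists_exp_mul_angularFourier_le {d : ℕ} {s : ℝ} (hs : 0 < s)
    {f : 𝓢(Rd d, ℂ)} (hf : HasDerivativeBounds s f) (j : Fin d) {r : ℝ} (hr : 0 < r) :
    ∃ C : ℝ, ∀ ξ, Real.exp (r * |ξ j| ^ (1 / s)) * ‖angularFourier ξ f‖ ≤ C := by
  obtain ⟨h, hh, hdecay⟩ := exists_exp_mul_le_of_forall_pow_mul_le hs hr
  -- The inverse of this weight is integrable, as `2 (d + 1) > d`, so the supremum bounds become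
  -- `L¹` bounds on the derivatives and hence moment bounds on the Fourier transform.
  obtain ⟨C, hC⟩ := hf ((1 + ∑ i, MvPolynomial.X i ^ 2) ^ (d + 1)) h hh
  have hweight : ∀ y : Rd d,
      ‖polyFn ((1 + ∑ i, MvPolynomial.X i ^ 2) ^ (d + 1)) y‖ = (1 + ‖y‖ ^ 2) ^ (d + 1) := by
    intro y
    have h1 : polyFn ((1 + ∑ i, MvPolynomial.X i ^ 2) ^ (d + 1)) y =
        (((1 + ‖y‖ ^ 2) ^ (d + 1) : ℝ) : ℂ) := by
      rw [EuclideanSpace.norm_sq_eq]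
      simp [polyFn]
    rw [h1, Complex.norm_real, Real.norm_of_nonneg (by positivity)]
  set w : Rd d → ℝ := fun y => (1 + ‖y‖ ^ 2) ^ (-(2 * ((d : ℝ) + 1)) / 2) with hw
  have hwint : Integrable w := by
    refine integrable_rpow_neg_one_add_norm_sq ?_
    rw [finrank_euclideanSpace_fin]
    linarith [(Nat.cast_nonneg d : (0 : ℝ) ≤ d)]
  have hw_inv : ∀ y, w y = ((1 + ‖y‖ ^ 2) ^ (d + 1))⁻¹ := by
    intro y
    have : -(2 * ((d : ℝ) + 1)) / 2 = -((d + 1 : ℕ) : ℝ) := by push_cast; ring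
    rw [hw]
    simp only
    rw [this, Real.rpow_neg (by positivity), Real.rpow_natCast]
  refine ⟨2 ^ s * (C * ∫ y, w y), fun ξ =>
    hdecay _ _ _ (abs_nonneg _) (norm_nonneg _) fun k => ?_⟩
  have h1 : |ξ j| ^ k * ‖angularFourier ξ f‖ = ‖angularFourier ξ ((partialD j)^[k] f)‖ := by
    rw [angularFourier_iterate_partialD]
    simp
  rw [h1]
  refine (norm_angularFourier_le _ _).trans ?_
  calc ∫ y, ‖(partialD j)^[k] f y‖
      ≤ ∫ y, C * (h ^ k * (k.factorial : ℝ) ^ s) * w y := by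
        refine integral_mono (SchwartzMap.integrable _).norm (hwint.const_mul _) fun y => ?_
        have := hC j k y
        rw [hweight] at this
        rw [hw_inv, ← div_eq_mul_inv, le_div_iff₀ (by positivity)]
        linarith
    _ = C * (∫ y, w y) * (h ^ k * (k.factorial : ℝ) ^ s) := by
        rw [integral_const_mul]
        ring

/-! ### Short-time Fourier transforms of the two distributions -/

theorem planeWave_zero_right {d : ℕ} (ξ : Rd d) : planeWave ξ 0 = 1 := by
  simp [planeWave]

theorem norm_planeWave {d : ℕ} (ξ y : Rd d) : ‖planeWave ξ y‖ = 1 := by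
  simp [planeWave, Complex.norm_exp]

theorem planeWave_add_right {d : ℕ} (ξ x y : Rd d) :
    planeWave ξ (x + y) = planeWave ξ x * planeWave ξ y := by
  simp [planeWave, inner_add_left, mul_add, Complex.exp_add]

/-- Replaces nested iterates by a single list of operators, which allows induction one derivative at
a time. -/
theorem foldr_iterate_eq_foldr_flatMap {ι V : Type*} (D : ι → V → V) (n : ι → ℕ) (L : List ι)
    (v : V) :
    L.foldr (fun i g => (D i)^[n i] g) v =
      (L.flatMap fun i => List.replicate (n i) i).foldr D v := by
  induction L with
  | nil => rfl
  | cons i L ih =>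
    have h : ∀ (k : ℕ) (w : V), (D i)^[k] w = (List.replicate k i).foldr D w := by
      intro k w
      induction k with
      | zero => rfl
      | succ k ihk =>
        rw [Function.iterate_succ_apply', ihk, List.replicate_succ, List.foldr_cons]
    rw [List.foldr_cons, ih, h, List.flatMap_cons, List.foldr_append]

/-- The partial derivative of a tempered distribution. -/
noncomputable def distD {d : ℕ} (i : Fin d) (u : 𝓢'(Rd d, ℂ)) : 𝓢'(Rd d, ℂ) :=
  ∂_{(EuclideanSpace.single i (1 : ℝ) : Rd d)} u

theorem distD_apply {d : ℕ} (i : Fin d) (u : 𝓢'(Rd d, ℂ)) (g : 𝓢(Rd d, ℂ)) :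
    distD i u g = -u (partialD i g) := by
  rw [distD, TemperedDistribution.lineDerivOp_apply_apply, map_neg]
  rfl

theorem multiD_distribution_eq {d : ℕ} (α : Fin d →₀ ℕ) (u : 𝓢'(Rd d, ℂ)) :
    multiD α u = (-Complex.I) ^ multiLength α • (indexList α).foldr distD u := by
  rw [indexList, ← foldr_iterate_eq_foldr_flatMap]
  rfl

/-- Each distributional derivative gives a sign and moves onto the test function, where the
modulation by `-ξ` contributes `κ = -i`. Plane waves equal `1` at the origin, so no phase remains.
-/
theorem foldr_distD_delta_apply {d : ℕ} (L : List (Fin d)) (x ξ : Rd d) (f : 𝓢(Rd d, ℂ)) :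
    L.foldr distD (TemperedDistribution.delta (0 : Rd d)) (modulation (-ξ) (translation x f)) =
      (-1) ^ L.length *
        polyFn (shiftPoly partialD (-Complex.I) (fun g : 𝓢(Rd d, ℂ) => g (-x)) L f) ξ := by
  induction L generalizing f with
  | nil => simp [shiftPoly, polyFn, planeWave_zero_right]
  | cons i L ih =>
    rw [List.foldr_cons, distD_apply, partialD_modulation, partialD_translation, map_add,
      map_smul, ih, ih, polyFn_shiftPoly_cons, List.length_cons, smul_eq_mul, PiLp.neg_apply]
    push_cast
    ring

theorem stft_diracCombination {d : ℕ} (p : MvPolynomial (Fin d) ℂ) (φ : 𝓢(Rd d, ℂ))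
    (x ξ : Rd d) :
    stft φ (diracCombination p) x ξ = polyFn (∑ α ∈ p.support,
      MvPolynomial.C ((((2 * Real.pi) ^ (-(d : ℝ) / 2) : ℝ) : ℂ) *
        (p.coeff α * ((-Complex.I) ^ multiLength α * (-1) ^ (indexList α).length))) *
      shiftPoly partialD (-Complex.I) (fun g : 𝓢(Rd d, ℂ) => g (-x)) (indexList α)
        (conjugate φ)) ξ := by
  rw [stft, sesqAction, conjugate_modulation_translation, diracCombination, sum_apply,
    Finset.mul_sum, polyFn, map_sum]
  refine Finset.sum_congr rfl fun α _ => ?_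
  rw [multiD_distribution_eq, smul_apply, smul_apply, foldr_distD_delta_apply, map_mul,
    MvPolynomial.eval_C, smul_eq_mul, smul_eq_mul, polyFn]
  ring

theorem integrable_mul_polyFn {d : ℕ} (p : MvPolynomial (Fin d) ℂ) (g : 𝓢(Rd d, ℂ)) :
    Integrable fun y => g y * polyFn p y := by
  have h := (SchwartzMap.smulLeftCLM ℂ (polyFn p) g).integrable (μ := volume)
  rw [SchwartzMap.smulLeftCLM_apply (polyFn_hasTemperateGrowth p)] at h
  simpa only [smul_eq_mul, mul_comm] using h

theorem polyDistribution_apply {d : ℕ} (p : MvPolynomial (Fin d) ℂ) (g : 𝓢(Rd d, ℂ)) :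
    polyDistribution p g = ∫ y, g y * polyFn p y :=
  rfl

theorem polyDistribution_X_mul {d : ℕ} (i : Fin d) (p : MvPolynomial (Fin d) ℂ)
    (g : 𝓢(Rd d, ℂ)) :
    polyDistribution (MvPolynomial.X i * p) g = polyDistribution p (coordMul i g) := by
  rw [polyDistribution_apply, polyDistribution_apply]
  refine integral_congr_ae (Eventually.of_forall fun y => ?_)
  simp [polyFn]
  ring

theorem polyDistribution_sum_C_mul {d : ℕ} {ι : Type*} (S : Finset ι) (c : ι → ℂ)
    (q : ι → MvPolynomial (Fin d) ℂ) (g : 𝓢(Rd d, ℂ)) :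
    polyDistribution (∑ k ∈ S, MvPolynomial.C (c k) * q k) g =
      ∑ k ∈ S, c k * polyDistribution (q k) g := by
  simp_rw [polyDistribution_apply, ← integral_const_mul]
  rw [← integral_finsetSum _ fun k _ => (integrable_mul_polyFn (q k) g).const_mul (c k)]
  refine integral_congr_ae (Eventually.of_forall fun y => ?_)
  simp only [polyFn, map_sum, map_mul, MvPolynomial.eval_C, Finset.mul_sum]
  exact Finset.sum_congr rfl fun k _ => by ring

theorem prod_map_X {d : ℕ} (L : List (Fin d)) :
    (L.map MvPolynomial.X).prod = MvPolynomial.monomial (listIndex L) (1 : ℂ) := by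
  induction L with
  | nil => simp
  | cons i L ih =>
    rw [List.map_cons, List.prod_cons, ih, listIndex_cons, MvPolynomial.X,
      MvPolynomial.monomial_mul, one_mul]

theorem polyDistribution_apply_eq_sum {d : ℕ} (p : MvPolynomial (Fin d) ℂ) (g : 𝓢(Rd d, ℂ)) :
    polyDistribution p g = ∑ α ∈ p.support,
      p.coeff α * polyDistribution ((indexList α).map MvPolynomial.X).prod g := by
  rw [← polyDistribution_sum_C_mul]
  congr 2
  conv_lhs => rw [p.as_sum]
  refine Finset.sum_congr rfl fun α _ => ?_
  rw [prod_map_X, listIndex_indexList, MvPolynomial.C_mul_monomial, mul_one]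

/-- Writing `y_i = (y_i - x_i) + x_i` gives the recursion with `κ = 1`. Without coordinate factors,
the substitution `y ↦ y + x` produces the phase times the Fourier transform. -/
theorem polyDistribution_prod_map_X_apply {d : ℕ} (L : List (Fin d)) (x ξ : Rd d)
    (f : 𝓢(Rd d, ℂ)) :
    polyDistribution (L.map MvPolynomial.X).prod (modulation (-ξ) (translation x f)) =
      planeWave (-ξ) x * polyFn (shiftPoly coordMul 1 (angularFourier ξ) L f) x := by
  induction L generalizing f with
  | nil =>
    rw [polyDistribution_apply]
    simp only [List.map_nil, List.prod_nil, polyFn, map_one, mul_one, shiftPoly,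
      MvPolynomial.eval_C, modulation_apply, translation_apply]
    rw [angularFourier_eq_integral, ← integral_const_mul,
      ← integral_sub_right_eq_self (fun y => planeWave (-ξ) x * (planeWave (-ξ) y * f y)) x]
    refine integral_congr_ae (Eventually.of_forall fun y => ?_)
    simp only
    rw [← mul_assoc, ← planeWave_add_right, add_sub_cancel]
  | cons i L ih =>
    rw [List.map_cons, List.prod_cons, polyDistribution_X_mul, coordMul_modulation_translation,
      map_add, map_smul, ih, ih, polyFn_shiftPoly_cons, smul_eq_mul]
    ring

theorem stft_polyDistribution {d : ℕ} (p : MvPolynomial (Fin d) ℂ) (φ : 𝓢(Rd d, ℂ))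
    (x ξ : Rd d) :
    stft φ (polyDistribution p) x ξ = planeWave (-ξ) x * polyFn (∑ α ∈ p.support,
      MvPolynomial.C ((((2 * Real.pi) ^ (-(d : ℝ) / 2) : ℝ) : ℂ) * p.coeff α) *
      shiftPoly coordMul 1 (angularFourier ξ) (indexList α) (conjugate φ)) x := by
  rw [stft, sesqAction, conjugate_modulation_translation, polyDistribution_apply_eq_sum,
    Finset.mul_sum, polyFn, map_sum, Finset.mul_sum]
  refine Finset.sum_congr rfl fun α _ => ?_
  rw [polyDistribution_prod_map_X_apply, map_mul, MvPolynomial.eval_C, polyFn]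
  ring

/-! ### The four wave front sets -/

theorem two_pi_rpow_ne_zero (a : ℝ) : (((2 * Real.pi) ^ a : ℝ) : ℂ) ≠ 0 :=
  Complex.ofReal_ne_zero.2 (by positivity)

theorem exists_apply_neg_ne_zero {d : ℕ} {f : 𝓢(Rd d, ℂ)} (hf : f ≠ 0) : ∃ x, f (-x) ≠ 0 := by
  by_contra! h
  exact hf (SchwartzMap.ext fun y => by simpa using h (-y))

theorem gaborWF_diracCombination {d : ℕ} {p : MvPolynomial (Fin d) ℂ} (hp : p ≠ 0)
    {φ : 𝓢(Rd d, ℂ)} (hφ : φ ≠ 0) :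
    gaborWF φ (diracCombination p) = {z | z.1 = 0 ∧ z.2 ≠ 0} := by
  rw [gaborWF_eq_conicSingularSet]
  refine conicSingularSet_eq_of_shiftPoly (ev := fun x (g : 𝓢(Rd d, ℂ)) => g (-x))
    (MvPolynomial.support_nonempty.2 hp)
    (fun α hα => mul_ne_zero (two_pi_rpow_ne_zero _)
      (mul_ne_zero (MvPolynomial.mem_support_iff.1 hα) (by simp)))
    (neg_ne_zero.2 Complex.I_ne_zero)
    (fun x ξ => congrArg norm (stft_diracCombination p φ x ξ))
    (exists_apply_neg_ne_zero (conjugate_ne_zero hφ)) fun N f => ?_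
  obtain ⟨C, hC⟩ := exists_one_add_norm_pow_mul_le f N
  exact ⟨C, fun x => by simpa using hC (-x)⟩

theorem gelfandShilovWF_diracCombination {d : ℕ} {p : MvPolynomial (Fin d) ℂ} (hp : p ≠ 0)
    {φ : 𝓢(Rd d, ℂ)} (hφ : φ ≠ 0) {t s : ℝ} (ht : 0 < t) (hs : 0 < s)
    (h : IsGelfandShilov t s φ) :
    gelfandShilovWF t s φ (diracCombination p) = {z | z.1 = 0 ∧ z.2 ≠ 0} := by
  rw [gelfandShilovWF_eq_anisotropicSingularSet]
  refine anisotropicSingularSet_eq_of_shiftPoly ht hs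
    (ev := fun x (g : 𝓢(Rd d, ℂ)) => g (-x)) (MvPolynomial.support_nonempty.2 hp)
    (fun α hα => mul_ne_zero (two_pi_rpow_ne_zero _)
      (mul_ne_zero (MvPolynomial.mem_support_iff.1 hα) (by simp)))
    (neg_ne_zero.2 Complex.I_ne_zero)
    (fun x ξ => congrArg norm (stft_diracCombination p φ x ξ))
    (exists_apply_neg_ne_zero (conjugate_ne_zero hφ)) h.conjugate.hasMomentBounds
    (fun i f hf => hf.partialD i) fun f hf j r hr => ?_
  obtain ⟨C, hC⟩ := hf.exists_exp_mul_le ht j hr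
  exact ⟨C, fun x => by simpa using hC (-x)⟩

theorem norm_stft_polyDistribution {d : ℕ} (p : MvPolynomial (Fin d) ℂ) (φ : 𝓢(Rd d, ℂ))
    (x ξ : Rd d) :
    ‖stft φ (polyDistribution p) x ξ‖ = ‖polyFn (∑ α ∈ p.support,
      MvPolynomial.C ((((2 * Real.pi) ^ (-(d : ℝ) / 2) : ℝ) : ℂ) * p.coeff α) *
      shiftPoly coordMul 1 (angularFourier ξ) (indexList α) (conjugate φ)) x‖ := by
  rw [stft_polyDistribution, norm_mul, norm_planeWave, one_mul]

theorem gaborWF_polyDistribution {d : ℕ} {p : MvPolynomial (Fin d) ℂ} (hp : p ≠ 0)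
    {φ : 𝓢(Rd d, ℂ)} (hφ : φ ≠ 0) :
    gaborWF φ (polyDistribution p) = {z | z.1 ≠ 0 ∧ z.2 = 0} := by
  rw [gaborWF_eq_conicSingularSet, conicSingularSet_flip,
    conicSingularSet_eq_of_shiftPoly (V := fun ξ x => stft φ (polyDistribution p) x ξ)
      (ev := angularFourier) (MvPolynomial.support_nonempty.2 hp)
      (fun α hα => mul_ne_zero (two_pi_rpow_ne_zero _) (MvPolynomial.mem_support_iff.1 hα))
      one_ne_zero (fun ξ x => norm_stft_polyDistribution p φ x ξ)
      (exists_angularFourier_ne_zero (conjugate_ne_zero hφ))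
      exists_one_add_norm_pow_mul_angularFourier_le]
  ext z
  simp [and_comm]

/-- After the flip `ξ` is the variable of decay, with exponent `s`, and the Gevrey bounds on
derivatives of the window take the place of its moment bounds. -/
theorem gelfandShilovWF_polyDistribution {d : ℕ} {p : MvPolynomial (Fin d) ℂ} (hp : p ≠ 0)
    {φ : 𝓢(Rd d, ℂ)} (hφ : φ ≠ 0) {t s : ℝ} (ht : 0 < t) (hs : 0 < s)
    (h : IsGelfandShilov t s φ) :
    gelfandShilovWF t s φ (polyDistribution p) = {z | z.1 ≠ 0 ∧ z.2 = 0} := by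
  rw [gelfandShilovWF_eq_anisotropicSingularSet, anisotropicSingularSet_flip,
    anisotropicSingularSet_eq_of_shiftPoly hs ht
      (V := fun ξ x => stft φ (polyDistribution p) x ξ)
      (ev := angularFourier) (MvPolynomial.support_nonempty.2 hp)
      (fun α hα => mul_ne_zero (two_pi_rpow_ne_zero _) (MvPolynomial.mem_support_iff.1 hα))
      one_ne_zero (fun ξ x => norm_stft_polyDistribution p φ x ξ)
      (exists_angularFourier_ne_zero (conjugate_ne_zero hφ)) h.conjugate.hasDerivativeBounds
      (fun i f hf => hf.coordMul hs i)
      fun f hf j r hr => hf.exists_exp_mul_angularFourier_le hs j hr]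
  ext z
  simp [and_comm]

end AnisotropicWF

theorem proposition7p2 {d : ℕ} (t s : ℝ) (ht : 0 < t) (hs : 0 < s) (hst : 1 < s + t)
    (p : MvPolynomial (Fin d) ℂ) (hp : p ≠ 0)
    (φ : 𝓢(AnisotropicWF.Rd d, ℂ)) (hφ : φ ≠ 0)
    (ψ : 𝓢(AnisotropicWF.Rd d, ℂ)) (hψ : AnisotropicWF.IsGelfandShilov t s ψ) (hψ0 : ψ ≠ 0) :
    (AnisotropicWF.gaborWF φ (AnisotropicWF.diracCombination p) = {z | z.1 = 0 ∧ z.2 ≠ 0} ∧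
      AnisotropicWF.gelfandShilovWF t s ψ (AnisotropicWF.diracCombination p) =
        {z | z.1 = 0 ∧ z.2 ≠ 0}) ∧
    (AnisotropicWF.gaborWF φ (AnisotropicWF.polyDistribution p) = {z | z.1 ≠ 0 ∧ z.2 = 0} ∧
      AnisotropicWF.gelfandShilovWF t s ψ (AnisotropicWF.polyDistribution p) =
        {z | z.1 ≠ 0 ∧ z.2 = 0}) :=
  ⟨⟨AnisotropicWF.gaborWF_diracCombination hp hφ,
      AnisotropicWF.gelfandShilovWF_diracCombination hp hψ0 ht hs hψ⟩,
    AnisotropicWF.gaborWF_polyDistribution hp hφ,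
    AnisotropicWF.gelfandShilovWF_polyDistribution hp hψ0 ht hs hψ⟩
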